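/- Let $M$ be a smooth surface and let $\mathcal A\subset TM\setminus 0$ be a conic sub-bundle, that is, a non-empty open set, invariant under positive scaling of tangent vectors, that projects onto $M$. A \emph{conic pseudo-Finsler metric} on $\mathcal A$ is a smooth function $F:\mathcal A\to\mathbb R$, positively homogeneous of degree $1$ in $y$, whose metric tensor $g_{ij}=\frac12\dot\partial_i\dot\partial_jF^2$ is non-degenerate, where $\dot\partial_i=\partial/\partial y^i$ and $\partial_i=\partial/\partial x^i$. Its geodesic spray, Barthel connection, Berwald connection and Berwald curvature are $$G^i=\tfrac14 g^{il}\bigl(y^r\partial_r\dot\partial_lF^2-\partial_lF^2\bigr),\quad G^i_j=\dot\partial_jG^i,\quad G^i_{jk}=\dot\partial_kG^i_j,\quad G^i_{jkl}=\dot\partial_lG^i_{jk},$$ and $\delta_i=\partial_i-G^j_i\dot\partial_j$. With $\varepsilon=\operatorname{sign}\det(g_{ij})$ and $\ell_i=\dot\partial_iF$, let $\ell^i=y^i/F$ and $(m^1,m^2)=\frac{\varepsilon}{\sqrt{\varepsilon\det(g_{ij})}}(-\ell_2,\ell_1)$, and for a smooth function $f$ on $\mathcal A$ put $f_{,1}=(\delta_if)\ell^i$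 and $f_{,2}=\varepsilon(\delta_if)m^i$. The metric $F$ is \emph{pseudo-Riemannian} if $F^2=a_{ij}(x)y^iy^j$ on $\mathcal A$ for some pseudo-Riemannian metric $a$ on $M$, and \emph{pseudo-Berwald} if $G^i_{jkl}=0$ on $\mathcal A$. A conic pseudo-Berwald metric is \emph{Riemann metrizable} if its Berwald connection coincides with the Levi-Civita connection of some pseudo-Riemannian metric on $M$, and it is \emph{Riemann metrizable by} the conic pseudo-Riemannian metric $F$ if this pseudo-Riemannian metric can be taken to be the metric $a$ that defines $F$. An \emph{anisotropic conformal change} of $F$ is $\overline F=e^{\phi}F$, where $\phi$ is smooth on $\mathcal A$, positively homogeneous of degree $0$ in $y$, and satisfies $F^2(\dot\partial_i\dot\partial_j\phi+\dot\partial_i\phi\,\dot\partial_j\phi)m^im^j+\varepsilon\neq0$ on $\mathcal A$. (1) Let $F$ be a conic pseudo-Riemannian metric on $\mathcal A$ and let $\overline F=e^{\phi}F$ be an anisotropic conformal change of $F$ that is conic pseudo-Berwald. Then $\overline F$ is Riemann metrizable by $F$ if and only if $\phi_{,1}=\phi_{,2}=0$ on $\mathcal A$ (the derivatives being taken with respect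 to $F$). Moreover $\phi_{,1}=\phi_{,2}=0$ on $\mathcal A$ if and only if $\phi$ is horizontally constant, i.e. $\delta_i\phi=0$ on $\mathcal A$. (2) Szabó's metrization theorem fails for conic pseudo-Finsler surfaces: on $M=\{(x_1,x_2)\in\mathbb R^2: x_2>0,\ 4x_1x_2<1\}$ put $c=1-2x_1x_2+\sqrt{1-4x_1x_2}$ and $\mathcal A=\{(x,y): y_2>0,\ 2x_2^2y_1+cy_2>0\}$, and let $$F=\frac1{x_2}\sqrt{2y_1y_2x_2^2+cy_2^2},\qquad \phi=\frac32\ln\frac{2x_2^2y_1+cy_2}{x_2^2y_2}.$$ Then $F$ is a conic pseudo-Riemannian metric, and $$\overline F=e^\phi F=4y_2\Bigl(\frac{c}{2x_2^2}+\frac{y_1}{y_2}\Bigr)^2$$ is an anisotropic conformal change of $F$ that is conic pseudo-Berwald. Neither $\phi_{,1}$ nor $\phi_{,2}$ vanishes anywhere on $\mathcal A$, so that $\overline F$ is not Riemann metrizable by $F$; moreover, $\overline F$ is not Riemann metrizable by any pseudo-Riemannian metric on $M$. -/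

import Mathlib

open scoped Manifold ContDiff Matrix

noncomputable section

namespace ConicFinsler

/-- The model plane `ℝ²` of a surface. -/
abbrev Plane : Type := EuclideanSpace ℝ (Fin 2)

/-- The tangent bundle `TM` of a surface `M`. -/
abbrev TB (M : Type*) [TopologicalSpace M] [ChartedSpace Plane M]
    [IsManifold 𝓘(ℝ, Plane) ∞ M] : Type _ :=
  TangentBundle 𝓘(ℝ, Plane) M

/-! ### Calculus in coordinates

A point of the coordinate space `Plane × Plane` is a pair `(x, y)`: the position `x` and the
directional argument `y`. The index set is `{0, 1}` in place of `{1, 2}`. -/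

/-- `∂f/∂xⁱ`. -/
def dx (i : Fin 2) (f : Plane × Plane → ℝ) (p : Plane × Plane) : ℝ :=
  fderiv ℝ f p (EuclideanSpace.single i 1, 0)

/-- `∂f/∂yⁱ`. -/
def dy (i : Fin 2) (f : Plane × Plane → ℝ) (p : Plane × Plane) : ℝ :=
  fderiv ℝ f p (0, EuclideanSpace.single i 1)

/-- The Finsler metric tensor `g_ij = (1/2) ∂²F²/∂yⁱ∂yʲ`. -/
def metricTensor (F : Plane × Plane → ℝ) (p : Plane × Plane) : Matrix (Fin 2) (Fin 2) ℝ :=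
  Matrix.of fun i j => (1 / 2) * dy i (dy j fun q => F q ^ 2) p

/-- The geodesic spray coefficients
`Gⁱ = (1/4) gⁱˡ (yʳ ∂²F²/∂xʳ∂yˡ - ∂F²/∂xˡ)`. -/
def sprayCoeff (F : Plane × Plane → ℝ) (i : Fin 2) (p : Plane × Plane) : ℝ :=
  (1 / 4) * ∑ l, (metricTensor F p)⁻¹ i l *
    ((∑ r, p.2 r * dx r (dy l fun q => F q ^ 2) p) - dx l (fun q => F q ^ 2) p)

/-- The Barthel connection `Gⁱ_j = ∂Gⁱ/∂yʲ`. -/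
def barthelCoeff (F : Plane × Plane → ℝ) (i j : Fin 2) (p : Plane × Plane) : ℝ :=
  dy j (sprayCoeff F i) p

/-- The Berwald connection `Gⁱ_jk = ∂Gⁱ_j/∂yᵏ`. -/
def berwaldCoeff (F : Plane × Plane → ℝ) (i j k : Fin 2) (p : Plane × Plane) : ℝ :=
  dy k (barthelCoeff F i j) p

/-- The Berwald curvature `Gⁱ_jkl = ∂Gⁱ_jk/∂yˡ`. -/
def berwaldCurv (F : Plane × Plane → ℝ) (i j k l : Fin 2) (p : Plane × Plane) : ℝ :=
  dy l (berwaldCoeff F i j k) p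

/-- The horizontal derivative `δ_i f = ∂f/∂xⁱ - Gʲ_i ∂f/∂yʲ` with respect to `F`. -/
def horDeriv (F : Plane × Plane → ℝ) (i : Fin 2) (f : Plane × Plane → ℝ)
    (p : Plane × Plane) : ℝ :=
  dx i f p - ∑ j, barthelCoeff F j i p * dy j f p

/-- The sign `ε = ±1` of `det (g_ij)`. -/
def frameSign (F : Plane × Plane → ℝ) (p : Plane × Plane) : ℝ :=
  Real.sign (metricTensor F p).det

/-- The first vector `ℓⁱ = yⁱ / F` of the modified Berwald frame. -/
def frameEll (F : Plane × Plane → ℝ) (i : Fin 2) (p : Plane × Plane) : ℝ :=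
  p.2 i / F p

/-- The second vector `(m¹, m²) = ε / √(ε det g) (-ℓ_2, ℓ_1)`, where `ℓ_i = ∂F/∂yⁱ`, of the
modified Berwald frame. -/
def frameM (F : Plane × Plane → ℝ) (i : Fin 2) (p : Plane × Plane) : ℝ :=
  frameSign F p / Real.sqrt (frameSign F p * (metricTensor F p).det) *
    ![-dy 1 F p, dy 0 F p] i

/-- The h-scalar derivative `f_{,1} = (δ_i f) ℓⁱ` with respect to `F`. -/
def hScalar1 (F f : Plane × Plane → ℝ) (p : Plane × Plane) : ℝ :=
  ∑ i, horDeriv F i f p * frameEll F i p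

/-- The h-scalar derivative `f_{,2} = ε (δ_i f) mⁱ` with respect to `F`. -/
def hScalar2 (F f : Plane × Plane → ℝ) (p : Plane × Plane) : ℝ :=
  frameSign F p * ∑ i, horDeriv F i f p * frameM F i p

/-! ### Geometric objects on a surface -/

section Surface

variable {M : Type*} [TopologicalSpace M] [ChartedSpace Plane M]
  [IsManifold 𝓘(ℝ, Plane) ∞ M]

/-- The tangent vector with coordinates `p = (x, y)` in the chart `e`. -/
def tangentOf (e : OpenPartialHomeomorph M Plane) (p : Plane × Plane) : TB M :=
  ⟨e.symm p.1, mfderiv 𝓘(ℝ, Plane) 𝓘(ℝ, Plane) e.symm p.1 p.2⟩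

/-- The coordinate expression in the chart `e` of a function on `TM`. -/
def localRep (e : OpenPartialHomeomorph M Plane) (F : TB M → ℝ) : Plane × Plane → ℝ :=
  fun p => F (tangentOf e p)

/-- The coordinate expression in the chart `e` of a subset of `TM`. -/
def localDom (e : OpenPartialHomeomorph M Plane) (A : Set (TB M)) : Set (Plane × Plane) :=
  {p | p.1 ∈ e.target ∧ tangentOf e p ∈ A}

/-- Multiplication of a tangent vector by a scalar. -/
def scale (c : ℝ) (v : TB M) : TB M := ⟨v.1, c • v.2⟩

/-- `A` is a conic sub-bundle of `TM`: a nonempty open set of nonzero tangent vectors, invariant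
under positive scaling, that projects onto `M`. -/
structure IsConicSubbundle (A : Set (TB M)) : Prop where
  isOpen : IsOpen A
  nonempty : A.Nonempty
  ne_zero : ∀ v ∈ A, v.2 ≠ 0
  scale_mem : ∀ v ∈ A, ∀ c : ℝ, 0 < c → scale c v ∈ A
  proj_surj : ∀ x : M, ∃ v ∈ A, v.1 = x

/-- `f` is smooth on `A`. -/
def SmoothOn (A : Set (TB M)) (f : TB M → ℝ) : Prop :=
  ContMDiffOn (𝓘(ℝ, Plane)).tangent 𝓘(ℝ, ℝ) ∞ f A

/-- `F` (restricted to `A`) is a conic pseudo-Finsler metric on `M`: `A` is a conic sub-bundle and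
`F` is smooth, positively homogeneous of degree one and has a nondegenerate metric tensor. -/
structure IsConicPseudoFinsler (A : Set (TB M)) (F : TB M → ℝ) : Prop where
  conic : IsConicSubbundle A
  smooth : SmoothOn A F
  homogeneous : ∀ v ∈ A, ∀ c : ℝ, 0 < c → F (scale c v) = c * F v
  nondegenerate : ∀ e ∈ atlas Plane M, ∀ p ∈ localDom e A,
    (metricTensor (localRep e F) p).det ≠ 0

/-- `F` is a conic pseudo-Berwald metric: its Berwald curvature vanishes. -/
structure IsConicPseudoBerwald (A : Set (TB M)) (F : TB M → ℝ) : Prop where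
  finsler : IsConicPseudoFinsler A F
  berwaldCurv_eq_zero : ∀ e ∈ atlas Plane M, ∀ p ∈ localDom e A, ∀ i j k l,
    berwaldCurv (localRep e F) i j k l p = 0

variable (M) in
/-- A pseudo-Riemannian metric on `M`: a smooth field of nondegenerate symmetric bilinear forms
on the tangent spaces. -/
structure PseudoRiemannianMetric where
  form : ∀ x : M, TangentSpace 𝓘(ℝ, Plane) x →ₗ[ℝ] TangentSpace 𝓘(ℝ, Plane) x →ₗ[ℝ] ℝ
  symm : ∀ x v w, form x v w = form x w v
  nondegenerate : ∀ x v, (∀ w, form x v w = 0) → v = 0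
  smooth : ∀ e ∈ atlas Plane M, ∀ i j : Fin 2, ContDiffOn ℝ ∞
    (fun u => form (e.symm u)
      (mfderiv 𝓘(ℝ, Plane) 𝓘(ℝ, Plane) e.symm u (EuclideanSpace.single i 1 : Plane))
      (mfderiv 𝓘(ℝ, Plane) 𝓘(ℝ, Plane) e.symm u (EuclideanSpace.single j 1 : Plane))) e.target

/-- The components `a_ij` of a pseudo-Riemannian metric in the chart `e`. -/
def PseudoRiemannianMetric.coeff (a : PseudoRiemannianMetric M)
    (e : OpenPartialHomeomorph M Plane) (u : Plane) : Matrix (Fin 2) (Fin 2) ℝ :=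
  Matrix.of fun i j => a.form (e.symm u)
    (mfderiv 𝓘(ℝ, Plane) 𝓘(ℝ, Plane) e.symm u (EuclideanSpace.single i 1 : Plane))
    (mfderiv 𝓘(ℝ, Plane) 𝓘(ℝ, Plane) e.symm u (EuclideanSpace.single j 1 : Plane))

/-- `∂a_ij/∂xᵏ` in the chart `e`. -/
def PseudoRiemannianMetric.dcoeff (a : PseudoRiemannianMetric M)
    (e : OpenPartialHomeomorph M Plane) (k i j : Fin 2) (u : Plane) : ℝ :=
  fderiv ℝ (fun w => a.coeff e w i j) u (EuclideanSpace.single k 1)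

/-- The Christoffel symbols `Γⁱ_jk = (1/2) aⁱˡ (∂_j a_lk + ∂_k a_lj - ∂_l a_jk)` of the Levi-Civita
connection in the chart `e`. -/
def PseudoRiemannianMetric.christoffel (a : PseudoRiemannianMetric M)
    (e : OpenPartialHomeomorph M Plane) (i j k : Fin 2) (u : Plane) : ℝ :=
  (1 / 2) * ∑ l, (a.coeff e u)⁻¹ i l *
    (a.dcoeff e j l k u + a.dcoeff e k l j u - a.dcoeff e l j k u)

/-- `F² = a_ij(x) yⁱ yʲ` on `A`. -/
def IsInducedBy (A : Set (TB M)) (F : TB M → ℝ) (a : PseudoRiemannianMetric M) : Prop :=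
  ∀ v ∈ A, F v ^ 2 = a.form v.1 v.2 v.2

/-- `F` is a conic pseudo-Riemannian metric: a conic pseudo-Finsler metric with
`F² = a_ij(x) yⁱ yʲ` for some pseudo-Riemannian metric `a` on `M`. -/
structure IsConicPseudoRiemannian (A : Set (TB M)) (F : TB M → ℝ) : Prop where
  finsler : IsConicPseudoFinsler A F
  induced : ∃ a : PseudoRiemannianMetric M, IsInducedBy A F a

/-- The Berwald connection of `F` is the Levi-Civita connection of `a`. -/
def HasLeviCivita (A : Set (TB M)) (F : TB M → ℝ) (a : PseudoRiemannianMetric M) : Prop :=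
  ∀ e ∈ atlas Plane M, ∀ p ∈ localDom e A, ∀ i j k,
    berwaldCoeff (localRep e F) i j k p = a.christoffel e i j k p.1

/-- `F'` is Riemann metrizable: its Berwald connection is the Levi-Civita connection of some
pseudo-Riemannian metric on `M`. -/
def IsRiemannMetrizable (A : Set (TB M)) (F' : TB M → ℝ) : Prop :=
  ∃ a : PseudoRiemannianMetric M, HasLeviCivita A F' a

/-- `F'` is Riemann metrizable by the conic pseudo-Riemannian metric `F`: its Berwald connection is
the Levi-Civita connection of the pseudo-Riemannian metric that induces `F`. -/
def IsRiemannMetrizableBy (A : Set (TB M)) (F' F : TB M → ℝ) : Prop :=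
  ∃ a : PseudoRiemannianMetric M, IsInducedBy A F a ∧ HasLeviCivita A F' a

/-- `φ` is the factor of an anisotropic conformal change of `F`: smooth on `A`, positively
homogeneous of degree zero, and
`F² (∂²φ/∂yⁱ∂yʲ + ∂φ/∂yⁱ ∂φ/∂yʲ) mⁱ mʲ + ε ≠ 0`. -/
structure IsAnisotropicConformalFactor (A : Set (TB M)) (F φ : TB M → ℝ) : Prop where
  smooth : SmoothOn A φ
  homogeneous : ∀ v ∈ A, ∀ c : ℝ, 0 < c → φ (scale c v) = φ v
  regular : ∀ e ∈ atlas Plane M, ∀ p ∈ localDom e A,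
    localRep e F p ^ 2 *
        (∑ i, ∑ j, (dy i (dy j (localRep e φ)) p + dy i (localRep e φ) p * dy j (localRep e φ) p) *
          frameM (localRep e F) i p * frameM (localRep e F) j p)
      + frameSign (localRep e F) p ≠ 0

/-- The changed metric `e^φ F`. -/
def conformalChange (φ F : TB M → ℝ) : TB M → ℝ := fun v => Real.exp (φ v) * F v

/-- `δ_i f = 0` on `A`: `f` is horizontally constant with respect to `F`. -/
def IsHorizontallyConstant (A : Set (TB M)) (F f : TB M → ℝ) : Prop :=
  ∀ e ∈ atlas Plane M, ∀ p ∈ localDom e A, ∀ i, horDeriv (localRep e F) i (localRep e f) p = 0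

/-- `f_{,1} = f_{,2} = 0` on `A`. -/
def HScalarsVanish (A : Set (TB M)) (F f : TB M → ℝ) : Prop :=
  ∀ e ∈ atlas Plane M, ∀ p ∈ localDom e A,
    hScalar1 (localRep e F) (localRep e f) p = 0 ∧ hScalar2 (localRep e F) (localRep e f) p = 0

/-- Neither `f_{,1}` nor `f_{,2}` vanishes anywhere on `A`. -/
def HScalarsNowhereVanish (A : Set (TB M)) (F f : TB M → ℝ) : Prop :=
  ∀ e ∈ atlas Plane M, ∀ p ∈ localDom e A,
    hScalar1 (localRep e F) (localRep e f) p ≠ 0 ∧ hScalar2 (localRep e F) (localRep e f) p ≠ 0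

end Surface

/-! ### The example

In this section the coordinates `(x₁, x₂; y₁, y₂)` are `x 0, x 1, y 0, y 1`. -/

/-- The surface `{x ∈ ℝ² | x₂ > 0, 4 x₁ x₂ < 1}`. -/
def exM : TopologicalSpace.Opens Plane where
  carrier := {x | 0 < x 1 ∧ 4 * (x 0 * x 1) < 1}
  is_open' :=
    (isOpen_lt continuous_const (by fun_prop : Continuous fun x : Plane => x 1)).inter
      (isOpen_lt (by fun_prop : Continuous fun x : Plane => 4 * (x 0 * x 1)) continuous_const)

/-- The position `x ∈ ℝ²` of a tangent vector of `exM`. -/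
def exX (v : TB exM) : Plane := (v.1 : Plane)

/-- The components `y ∈ ℝ²` of a tangent vector of `exM`, an open subset of `ℝ²`. -/
def exY (v : TB exM) : Plane :=
  mfderiv 𝓘(ℝ, Plane) 𝓘(ℝ, Plane) (Subtype.val : exM → Plane) v.1 v.2

/-- `c = 1 - 2 x₁ x₂ + √(1 - 4 x₁ x₂)`. -/
def exC (x : Plane) : ℝ := 1 - 2 * x 0 * x 1 + Real.sqrt (1 - 4 * x 0 * x 1)

/-- The conic domain `y₂ > 0`, `2 x₂² y₁ + c y₂ > 0`. -/
def exA : Set (TB exM) :=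
  {v | 0 < exY v 1 ∧ 0 < 2 * exX v 1 ^ 2 * exY v 0 + exC (exX v) * exY v 1}

/-- `F = (1 / x₂) √(2 y₁ y₂ x₂² + c y₂²)`. -/
def exF (v : TB exM) : ℝ :=
  1 / exX v 1 * Real.sqrt (2 * exY v 0 * exY v 1 * exX v 1 ^ 2 + exC (exX v) * exY v 1 ^ 2)

/-- `φ = (3 / 2) log ((2 x₂² y₁ + c y₂) / (x₂² y₂))`. -/
def exPhi (v : TB exM) : ℝ :=
  3 / 2 * Real.log ((2 * exX v 1 ^ 2 * exY v 0 + exC (exX v) * exY v 1) /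
    (exX v 1 ^ 2 * exY v 1))

end ConicFinsler

end

/-!
The proof rests on a characterization of the connection of a conic pseudo-Finsler metric `F` in
coordinates. On the one hand, its Barthel connection is conservative: `δ_i F² = 0`
(`IsLocalFinsler.dx_sq_eq`), which is Euler's identity combined with the symmetry of second
derivatives. On the other hand, if `Γ` is a symmetric linear connection with
`∂_i F² = Γʲ_ik yᵏ ∂F²/∂yʲ`, then the spray of `F` is `½ Γⁱ_jk yʲ yᵏ`, so that `Γ` is the Berwald
connection of `F` and the Berwald curvature vanishes (`IsLocalFinsler.sprayCoeff_eq_of_dx_sq` and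
its consequences). Only first derivatives in the position are needed to apply this.

For the criterion, let `F² = a_ij yⁱ yʲ` and let `Γ` be the Levi-Civita connection of `a`. Metric
compatibility says that `Γ` satisfies the hypothesis above, so `δ_i` is formed with `Γⁱ_jk yᵏ`. If
the Berwald connection of `e^φ F` is `Γ` as well, the same `δ_i` annihilates `F` and `e^φ F`, hence
`φ`. If `δ_i φ = 0`, then `δ_i` annihilates `e^φ F`, and the characterization shows that `Γ` is its
Berwald connection (`hasLeviCivita_conformalChange_iff`). The vectors `ℓ` and `m` form a basis, so
the two h-scalar derivatives of `φ` vanish exactly if `δ_i φ = 0`. Here one uses that a smooth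
pseudo-Finsler metric has no zeros.

For the example, put `b = c / x₂²` and `β = 2 y₁ + b y₂`, so that `F² = y₂ β`,
`φ = (3/2) log (β / y₂)` and `e^φ F = β² / y₂`. The torsion-free connection with `∇β = θ ⊗ β` and
`∇dx₂ = 2 θ ⊗ dx₂`, where `θ = -½ (∂b/∂x₁) dx₂`, preserves `β² / dx₂`, and is therefore the Berwald
connection of `e^φ F`. With respect to `F` one finds `δ₁φ = 0` and `δ₂φ = -(3/2) ∂b/∂x₁ ≠ 0`. A
Levi-Civita connection has the trace `½ d log |det a|`, a closed form, while the trace of `∇` is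
`-3 θ`, which is not closed since `∂²b/∂x₁² ≠ 0` (`not_isRiemannMetrizable_example`).
-/

namespace ConicFinsler

/-! ### Partial derivatives in position and direction -/

section Calculus

variable {U : Set (Plane × Plane)} {f g : Plane × Plane → ℝ} {p : Plane × Plane}

lemma dy_congr (hU : IsOpen U) (h : Set.EqOn f g U) (hp : p ∈ U) (i : Fin 2) :
    dy i f p = dy i g p := by
  unfold dy
  rw [(h.eventuallyEq_of_mem (hU.mem_nhds hp)).fderiv_eq]

lemma dx_congr (hU : IsOpen U) (h : Set.EqOn f g U) (hp : p ∈ U) (i : Fin 2) :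
    dx i f p = dx i g p := by
  unfold dx
  rw [(h.eventuallyEq_of_mem (hU.mem_nhds hp)).fderiv_eq]

lemma differentiableAt_of_contDiffOn (hU : IsOpen U) (hf : ContDiffOn ℝ ∞ f U) (hp : p ∈ U) :
    DifferentiableAt ℝ f p :=
  (hf.contDiffAt (hU.mem_nhds hp)).differentiableAt (by simp)

lemma contDiffOn_dy (hU : IsOpen U) (hf : ContDiffOn ℝ ∞ f U) (i : Fin 2) :
    ContDiffOn ℝ ∞ (dy i f) U :=
  (hf.fderiv_of_isOpen hU (by simp)).clm_apply contDiffOn_const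

lemma contDiffOn_dx (hU : IsOpen U) (hf : ContDiffOn ℝ ∞ f U) (i : Fin 2) :
    ContDiffOn ℝ ∞ (dx i f) U :=
  (hf.fderiv_of_isOpen hU (by simp)).clm_apply contDiffOn_const

lemma contDiff_dir (i : Fin 2) : ContDiff ℝ ∞ (fun q : Plane × Plane => q.2 i) := by fun_prop

lemma fderiv_fderiv_comm {E : Type*} [NormedAddCommGroup E] [NormedSpace ℝ E] {f : E → ℝ} {x : E}
    (hf : ContDiffAt ℝ ∞ f x) (v w : E) :
    fderiv ℝ (fun q => fderiv ℝ f q v) x w = fderiv ℝ (fun q => fderiv ℝ f q w) x v := by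
  have hd : DifferentiableAt ℝ (fderiv ℝ f) x :=
    (hf.fderiv_right (m := 1) (by norm_cast)).differentiableAt (by simp)
  have hs : IsSymmSndFDerivAt ℝ f x := hf.isSymmSndFDerivAt (by
    rw [minSmoothness_of_isRCLikeNormedField]; norm_cast)
  have key : ∀ u z : E, fderiv ℝ (fun q => fderiv ℝ f q u) x z = fderiv ℝ (fderiv ℝ f) x z u := by
    intro u z
    rw [fderiv_clm_apply hd (differentiableAt_const u)]
    simp
  rw [key, key, hs.eq]

lemma dy_dy_comm (hU : IsOpen U) (hf : ContDiffOn ℝ ∞ f U) (hp : p ∈ U) (i j : Fin 2) :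
    dy i (dy j f) p = dy j (dy i f) p :=
  fderiv_fderiv_comm (hf.contDiffAt (hU.mem_nhds hp)) _ _

lemma dy_dx_comm (hU : IsOpen U) (hf : ContDiffOn ℝ ∞ f U) (hp : p ∈ U) (i j : Fin 2) :
    dy i (dx j f) p = dx j (dy i f) p :=
  fderiv_fderiv_comm (hf.contDiffAt (hU.mem_nhds hp)) _ _

lemma dy_mul (hf : DifferentiableAt ℝ f p) (hg : DifferentiableAt ℝ g p) (i : Fin 2) :
    dy i (fun q => f q * g q) p = dy i f p * g p + f p * dy i g p := by
  unfold dy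
  rw [fderiv_fun_mul hf hg]
  simp; ring

lemma dx_mul (hf : DifferentiableAt ℝ f p) (hg : DifferentiableAt ℝ g p) (i : Fin 2) :
    dx i (fun q => f q * g q) p = dx i f p * g p + f p * dx i g p := by
  unfold dx
  rw [fderiv_fun_mul hf hg]
  simp; ring

lemma dy_add (hf : DifferentiableAt ℝ f p) (hg : DifferentiableAt ℝ g p) (i : Fin 2) :
    dy i (fun q => f q + g q) p = dy i f p + dy i g p := by
  unfold dy
  rw [fderiv_fun_add hf hg]
  simp

lemma dy_mul_add_mul {f' g' : Plane × Plane → ℝ} (hf : DifferentiableAt ℝ f p)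
    (hg : DifferentiableAt ℝ g p) (hf' : DifferentiableAt ℝ f' p) (hg' : DifferentiableAt ℝ g' p)
    (i : Fin 2) :
    dy i (fun q => f q * g q + f' q * g' q) p =
      dy i f p * g p + f p * dy i g p + (dy i f' p * g' p + f' p * dy i g' p) := by
  rw [dy_add (hf.fun_mul hg) (hf'.fun_mul hg'), dy_mul hf hg, dy_mul hf' hg']

lemma dy_sq (hf : DifferentiableAt ℝ f p) (i : Fin 2) :
    dy i (fun q => f q ^ 2) p = 2 * f p * dy i f p := by
  simp only [sq, dy_mul hf hf]; ring

lemma dx_sq (hf : DifferentiableAt ℝ f p) (i : Fin 2) :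
    dx i (fun q => f q ^ 2) p = 2 * f p * dx i f p := by
  simp only [sq, dx_mul hf hf]; ring

lemma dy_exp (hf : DifferentiableAt ℝ f p) (i : Fin 2) :
    dy i (fun q => Real.exp (f q)) p = Real.exp (f p) * dy i f p := by
  unfold dy
  rw [fderiv_exp hf]; simp

lemma dx_exp (hf : DifferentiableAt ℝ f p) (i : Fin 2) :
    dx i (fun q => Real.exp (f q)) p = Real.exp (f p) * dx i f p := by
  unfold dx
  rw [fderiv_exp hf]; simp

/-- The directional partial derivative of a differentiable function is its derivative along the
coordinate line in the fibre. -/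
lemma dy_eq_of_hasDerivAt (hf : DifferentiableAt ℝ f p) (i : Fin 2) {f' : ℝ}
    (h : HasDerivAt (fun t : ℝ => f (p.1, p.2 + t • EuclideanSpace.single i 1)) f' 0) :
    dy i f p = f' := by
  have h1 : HasLineDerivAt ℝ f (dy i f p) p (0, EuclideanSpace.single i 1) :=
    hf.hasFDerivAt.hasLineDerivAt _
  have h2 : (fun t : ℝ => f (p + t • ((0 : Plane), (EuclideanSpace.single i 1 : Plane)))) =
      fun t : ℝ => f (p.1, p.2 + t • EuclideanSpace.single i 1) := by
    funext t; congr 1; ext <;> simp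
  unfold HasLineDerivAt at h1
  rw [h2] at h1
  exact h1.unique h

/-- The directional partial derivatives depend only on the values along the fibre, so that
functions of the position alone may be treated as constants, whether or not they are
differentiable. -/
lemma dy_congr_fiber (hU : IsOpen U) (hp : p ∈ U) (hf : DifferentiableAt ℝ f p)
    (hg : DifferentiableAt ℝ g p) (h : ∀ q ∈ U, q.1 = p.1 → f q = g q) (i : Fin 2) :
    dy i f p = dy i g p := by
  apply dy_eq_of_hasDerivAt hf
  have h1 : HasDerivAt (fun t : ℝ => g (p.1, p.2 + t • EuclideanSpace.single i 1))
      (dy i g p) 0 := by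
    have h1 : HasLineDerivAt ℝ g (dy i g p) p (0, EuclideanSpace.single i 1) :=
      hg.hasFDerivAt.hasLineDerivAt _
    have h2 : (fun t : ℝ => g (p + t • ((0 : Plane), (EuclideanSpace.single i 1 : Plane)))) =
        fun t : ℝ => g (p.1, p.2 + t • EuclideanSpace.single i 1) := by
      funext t; congr 1; ext <;> simp
    unfold HasLineDerivAt at h1
    rwa [h2] at h1
  refine h1.congr_of_eventuallyEq ?_
  have hc : Continuous fun t : ℝ => (p.1, p.2 + t • (EuclideanSpace.single i 1 : Plane)) := by
    fun_prop
  have : ∀ᶠ t in nhds (0 : ℝ), (p.1, p.2 + t • (EuclideanSpace.single i 1 : Plane)) ∈ U :=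
    hc.continuousAt.eventually (hU.mem_nhds (by simpa using hp))
  filter_upwards [this] with t ht
  exact h _ ht rfl

lemma dy_coord (i j : Fin 2) (p : Plane × Plane) :
    dy i (fun q => q.2 j) p = if i = j then 1 else 0 := by
  apply dy_eq_of_hasDerivAt (by fun_prop)
  by_cases h : i = j
  · subst h
    simpa using (hasDerivAt_id (0 : ℝ)).const_add (p.2 i)
  · have h' : j ≠ i := fun e => h e.symm
    simpa [h, h'] using hasDerivAt_const (0 : ℝ) (p.2 j)

lemma dy_const_mul (c : ℝ) (hf : DifferentiableAt ℝ f p) (i : Fin 2) :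
    dy i (fun q => c * f q) p = c * dy i f p := by
  unfold dy
  rw [fderiv_const_mul hf]; simp

lemma dy_linear (γ : Fin 2 → ℝ) (i : Fin 2) (p : Plane × Plane) :
    dy i (fun q => ∑ k, γ k * q.2 k) p = γ i := by
  simp only [Fin.sum_univ_two]
  simp (disch := fun_prop) only [dy_add, dy_const_mul, dy_coord]
  fin_cases i <;> simp

lemma dy_const (c : ℝ) (i : Fin 2) (p : Plane × Plane) : dy i (fun _ => c) p = 0 := by
  simp [dy]

lemma dy_quadratic (γ : Fin 2 → Fin 2 → ℝ) (hγ : ∀ j k, γ j k = γ k j) (i : Fin 2)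
    (p : Plane × Plane) :
    dy i (fun q => ∑ j, ∑ k, γ j k * q.2 j * q.2 k) p = 2 * ∑ k, γ i k * p.2 k := by
  have h0 := hγ 0 1
  simp only [Fin.sum_univ_two]
  simp (disch := fun_prop) only [dy_add, dy_mul, dy_const, dy_coord]
  fin_cases i <;> simp <;> rw [h0] <;> ring

lemma dx_add (hf : DifferentiableAt ℝ f p) (hg : DifferentiableAt ℝ g p) (i : Fin 2) :
    dx i (fun q => f q + g q) p = dx i f p + dx i g p := by
  unfold dx
  rw [fderiv_fun_add hf hg]
  simp

lemma dx_comp_fst {b : Plane → ℝ} (hb : DifferentiableAt ℝ b p.1) (i : Fin 2) :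
    dx i (fun q => b q.1) p = fderiv ℝ b p.1 (EuclideanSpace.single i 1) := by
  have h : HasFDerivAt (fun q : Plane × Plane => b q.1)
      ((fderiv ℝ b p.1).comp (ContinuousLinearMap.fst ℝ Plane Plane)) p :=
    hb.hasFDerivAt.comp p hasFDerivAt_fst
  simp [dx, h.fderiv]

lemma dx_comp_snd {b : Plane → ℝ} (hb : DifferentiableAt ℝ b p.2) (i : Fin 2) :
    dx i (fun q => b q.2) p = 0 := by
  have h : HasFDerivAt (fun q : Plane × Plane => b q.2)
      ((fderiv ℝ b p.2).comp (ContinuousLinearMap.snd ℝ Plane Plane)) p :=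
    hb.hasFDerivAt.comp p hasFDerivAt_snd
  simp [dx, h.fderiv]

lemma dx_coord (i j : Fin 2) (p : Plane × Plane) : dx i (fun q => q.2 j) p = 0 :=
  dx_comp_snd (b := fun y => y j) (by fun_prop) i

lemma dy_comp {g : ℝ → ℝ} {g' : ℝ} (hg : HasDerivAt g g' (f p)) (hf : DifferentiableAt ℝ f p)
    (i : Fin 2) : dy i (fun q => g (f q)) p = g' * dy i f p := by
  have h := hg.comp_hasFDerivAt p hf.hasFDerivAt
  simp only [dy]
  rw [show (fun q => g (f q)) = g ∘ f from rfl, h.fderiv]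
  simp

lemma dx_comp {g : ℝ → ℝ} {g' : ℝ} (hg : HasDerivAt g g' (f p)) (hf : DifferentiableAt ℝ f p)
    (i : Fin 2) : dx i (fun q => g (f q)) p = g' * dx i f p := by
  have h := hg.comp_hasFDerivAt p hf.hasFDerivAt
  simp only [dx]
  rw [show (fun q => g (f q)) = g ∘ f from rfl, h.fderiv]
  simp

lemma dy_comp_fst {b : Plane → ℝ} (hb : DifferentiableAt ℝ b p.1) (i : Fin 2) :
    dy i (fun q => b q.1) p = 0 := by
  have h : HasFDerivAt (fun q : Plane × Plane => b q.1)
      ((fderiv ℝ b p.1).comp (ContinuousLinearMap.fst ℝ Plane Plane)) p :=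
    hb.hasFDerivAt.comp p hasFDerivAt_fst
  simp [dy, h.fderiv]

end Calculus

/-! ### Positive homogeneity -/

/-- The dilation of the directional argument by a nonzero factor, as a linear automorphism of the
coordinate space. -/
noncomputable def dilation (t : ℝ) (ht : t ≠ 0) : (Plane × Plane) ≃L[ℝ] (Plane × Plane) :=
  (ContinuousLinearEquiv.refl ℝ Plane).prodCongr
    (ContinuousLinearEquiv.smulLeft (Units.mk0 t ht))

lemma dilation_apply (t : ℝ) (ht : t ≠ 0) (p : Plane × Plane) :
    dilation t ht p = (p.1, t • p.2) := rfl

/-- `f` is positively homogeneous of degree `n` in the directional argument on `U`. -/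
def IsHomog (U : Set (Plane × Plane)) (n : ℕ) (f : Plane × Plane → ℝ) : Prop :=
  ∀ p ∈ U, ∀ t : ℝ, 0 < t → f (p.1, t • p.2) = t ^ n * f p

section Homogeneous

variable {U : Set (Plane × Plane)} {f g : Plane × Plane → ℝ} {n : ℕ} {p : Plane × Plane}

lemma IsHomog.fderiv_apply (hU : IsOpen U) (h : IsHomog U n f) (hp : p ∈ U) {t : ℝ} (ht : 0 < t)
    (v : Plane × Plane) :
    fderiv ℝ f (p.1, t • p.2) (v.1, t • v.2) = t ^ n * fderiv ℝ f p v := by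
  have h1 : fderiv ℝ (f ∘ dilation t ht.ne') p = fderiv ℝ (fun q => t ^ n * f q) p := by
    apply Filter.EventuallyEq.fderiv_eq
    filter_upwards [hU.mem_nhds hp] with q hq
    exact h q hq t ht
  rw [ContinuousLinearEquiv.comp_right_fderiv] at h1
  have h2 : fderiv ℝ (fun q => t ^ n * f q) p = t ^ n • fderiv ℝ f p := by
    have := congrFun (fderiv_const_smul_field (𝕜 := ℝ) (f := f) (t ^ n)) p
    simpa [Pi.smul_def] using this
  rw [h2] at h1
  simpa [dilation_apply] using congrArg (fun l => l v) h1

lemma IsHomog.dx (hU : IsOpen U) (h : IsHomog U n f) (i : Fin 2) : IsHomog U n (dx i f) := by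
  intro p hp t ht
  have h1 := h.fderiv_apply hU hp ht (EuclideanSpace.single i 1, 0)
  rwa [smul_zero] at h1

lemma IsHomog.dy (hU : IsOpen U) (h : IsHomog U (n + 1) f) (i : Fin 2) :
    IsHomog U n (dy i f) := by
  intro p hp t ht
  have h1 := h.fderiv_apply hU hp ht (0, EuclideanSpace.single i 1)
  have h2 : ((0 : Plane), t • (EuclideanSpace.single i 1 : Plane)) =
      t • ((0 : Plane), (EuclideanSpace.single i 1 : Plane)) := by simp
  simp only at h1
  rw [h2, map_smul, smul_eq_mul, pow_succ', mul_assoc] at h1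
  exact mul_left_cancel₀ ht.ne' h1

/-- Euler's identity. -/
lemma IsHomog.euler (h : IsHomog U n f) (hp : p ∈ U) (hf : DifferentiableAt ℝ f p) :
    ∑ i, p.2 i * ConicFinsler.dy i f p = n * f p := by
  have hc : HasDerivAt (fun t : ℝ => f (p.1, t • p.2)) (fderiv ℝ f p (0, p.2)) 1 := by
    have hl : HasDerivAt (fun t : ℝ => (p.1, t • p.2)) ((0 : Plane), p.2) 1 := by
      have := (hasDerivAt_id (1 : ℝ)).smul_const p.2
      simpa using (hasDerivAt_const (1 : ℝ) p.1).prodMk this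
    have hf' : HasFDerivAt f (fderiv ℝ f p) (p.1, (1 : ℝ) • p.2) := by
      simpa using hf.hasFDerivAt
    exact hf'.comp_hasDerivAt (1 : ℝ) hl
  have hm : HasDerivAt (fun t : ℝ => t ^ n * f p) (n * f p) 1 := by
    simpa using (hasDerivAt_pow n (1 : ℝ)).mul_const (f p)
  have he : (fun t : ℝ => f (p.1, t • p.2)) =ᶠ[nhds 1] fun t => t ^ n * f p := by
    filter_upwards [lt_mem_nhds (zero_lt_one' ℝ)] with t ht
    exact h p hp t ht
  rw [← hc.unique (hm.congr_of_eventuallyEq he)]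
  have hv : ((0 : Plane), p.2) =
      ∑ i, p.2 i • ((0 : Plane), (EuclideanSpace.single i 1 : Plane)) := by
    ext k
    · simp [Fin.sum_univ_two]
    · fin_cases k <;> simp [Fin.sum_univ_two]
  rw [hv, map_sum]
  simp only [map_smul, smul_eq_mul]
  rfl

end Homogeneous

/-! ### Pseudo-Finsler metrics in coordinates -/

/-- `F` is the coordinate expression of a conic pseudo-Finsler metric on the conic open set `U` of
the coordinate space. -/
structure IsLocalFinsler (U : Set (Plane × Plane)) (F : Plane × Plane → ℝ) : Prop where
  isOpen : IsOpen U
  scale_mem : ∀ p ∈ U, ∀ t : ℝ, 0 < t → (p.1, t • p.2) ∈ U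
  dir_ne_zero : ∀ p ∈ U, p.2 ≠ 0
  smooth : ContDiffOn ℝ ∞ F U
  homog : IsHomog U 1 F
  nondegenerate : ∀ p ∈ U, (metricTensor F p).det ≠ 0

/-- The covector `yʳ ∂²F²/∂xʳ∂yˡ - ∂F²/∂xˡ` from which the spray is obtained by raising the
index. -/
noncomputable def sprayCovector (F : Plane × Plane → ℝ) (l : Fin 2)
    (p : Plane × Plane) : ℝ :=
  (∑ r, p.2 r * dx r (dy l fun q => F q ^ 2) p) - dx l (fun q => F q ^ 2) p

namespace IsLocalFinsler

variable {U : Set (Plane × Plane)} {F : Plane × Plane → ℝ} {p : Plane × Plane}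

lemma smooth_sq (h : IsLocalFinsler U F) : ContDiffOn ℝ ∞ (fun q => F q ^ 2) U := h.smooth.pow 2

lemma homog_sq (h : IsLocalFinsler U F) : IsHomog U 2 (fun q => F q ^ 2) := by
  intro p hp t ht
  simp only [h.homog p hp t ht]
  ring

lemma differentiableAt (h : IsLocalFinsler U F) (hp : p ∈ U) : DifferentiableAt ℝ F p :=
  differentiableAt_of_contDiffOn h.isOpen h.smooth hp

lemma smooth_metricTensor (h : IsLocalFinsler U F) (i j : Fin 2) :
    ContDiffOn ℝ ∞ (fun p => metricTensor F p i j) U :=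
  contDiffOn_const.mul (contDiffOn_dy h.isOpen (contDiffOn_dy h.isOpen h.smooth_sq j) i)

lemma smooth_metricTensor_inv (h : IsLocalFinsler U F) (i j : Fin 2) :
    ContDiffOn ℝ ∞ (fun p => (metricTensor F p)⁻¹ i j) U := by
  have hg := h.smooth_metricTensor
  have hdet : ContDiffOn ℝ ∞ (fun p => (metricTensor F p).det) U := by
    simp only [Matrix.det_fin_two]
    exact ((hg 0 0).mul (hg 1 1)).sub ((hg 0 1).mul (hg 1 0))
  have hadj : ContDiffOn ℝ ∞ (fun p => (metricTensor F p).adjugate i j) U := by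
    simp only [Matrix.adjugate_fin_two]
    fin_cases i <;> fin_cases j <;> simp
    · exact hg 1 1
    · exact (hg 0 1).neg
    · exact (hg 1 0).neg
    · exact hg 0 0
  simp only [Matrix.inv_def, Ring.inverse_eq_inv', Matrix.smul_apply, smul_eq_mul]
  exact (hdet.inv h.nondegenerate).mul hadj

lemma smooth_sprayCovector (h : IsLocalFinsler U F) (l : Fin 2) :
    ContDiffOn ℝ ∞ (sprayCovector F l) U := by
  unfold sprayCovector
  refine ContDiffOn.sub (ContDiffOn.sum fun r _ => ?_) (contDiffOn_dx h.isOpen h.smooth_sq l)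
  exact (contDiff_dir r).contDiffOn.mul
    (contDiffOn_dx h.isOpen (contDiffOn_dy h.isOpen h.smooth_sq l) r)

lemma smooth_sprayCoeff (h : IsLocalFinsler U F) (i : Fin 2) :
    ContDiffOn ℝ ∞ (sprayCoeff F i) U :=
  contDiffOn_const.mul (ContDiffOn.sum fun l _ =>
    (h.smooth_metricTensor_inv i l).mul (h.smooth_sprayCovector l))

lemma smooth_barthelCoeff (h : IsLocalFinsler U F) (i j : Fin 2) :
    ContDiffOn ℝ ∞ (barthelCoeff F i j) U :=
  contDiffOn_dy h.isOpen (h.smooth_sprayCoeff i) j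

lemma smooth_berwaldCoeff (h : IsLocalFinsler U F) (i j k : Fin 2) :
    ContDiffOn ℝ ∞ (berwaldCoeff F i j k) U :=
  contDiffOn_dy h.isOpen (h.smooth_barthelCoeff i j) k

/-- The spray coefficients solve the linear system that defines them. -/
lemma sum_metricTensor_mul_sprayCoeff (h : IsLocalFinsler U F) (hp : p ∈ U) (l : Fin 2) :
    ∑ j, metricTensor F p l j * sprayCoeff F j p = 1 / 4 * sprayCovector F l p := by
  have hinv : metricTensor F p * (metricTensor F p)⁻¹ = 1 :=
    Matrix.mul_nonsing_inv _ (isUnit_iff_ne_zero.2 (h.nondegenerate p hp))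
  have hs : (fun j => sprayCoeff F j p) =
      (1 / 4 : ℝ) • (metricTensor F p)⁻¹ *ᵥ fun l => sprayCovector F l p := by
    funext j
    simp only [sprayCoeff, sprayCovector, Matrix.mulVec, dotProduct, Pi.smul_apply, smul_eq_mul]
  have : metricTensor F p *ᵥ (fun j => sprayCoeff F j p) =
      (1 / 4 : ℝ) • fun l => sprayCovector F l p := by
    rw [hs, Matrix.mulVec_smul, Matrix.mulVec_mulVec, hinv, Matrix.one_mulVec]
  simpa [Matrix.mulVec, dotProduct] using congrFun this l

/-- The spray coefficients are the only solution of the linear system that defines them. -/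
lemma sprayCoeff_eq_of_sum (h : IsLocalFinsler U F) (hp : p ∈ U) {Q : Fin 2 → ℝ}
    (hQ : ∀ l, ∑ j, metricTensor F p l j * Q j = 1 / 4 * sprayCovector F l p) (i : Fin 2) :
    sprayCoeff F i p = Q i := by
  have hu : IsUnit (metricTensor F p) :=
    (Matrix.isUnit_iff_isUnit_det _).2 (isUnit_iff_ne_zero.2 (h.nondegenerate p hp))
  have : metricTensor F p *ᵥ (fun j => sprayCoeff F j p) = metricTensor F p *ᵥ Q := by
    funext l
    simp only [Matrix.mulVec, dotProduct]
    rw [hQ, h.sum_metricTensor_mul_sprayCoeff hp]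
  exact congrFun (Matrix.mulVec_injective_iff_isUnit.2 hu this) i

lemma euler_dy_sq (h : IsLocalFinsler U F) (hp : p ∈ U) (i : Fin 2) :
    ∑ j, p.2 j * dy j (dy i fun q => F q ^ 2) p = dy i (fun q => F q ^ 2) p := by
  simpa using (IsHomog.dy h.isOpen (n := 1) h.homog_sq i).euler hp
    (differentiableAt_of_contDiffOn h.isOpen (contDiffOn_dy h.isOpen h.smooth_sq i) hp)

/-- A smooth pseudo-Finsler metric has no zeros: by Euler's identity `g_ij yʲ = F ∂F/∂yⁱ`, so that
a zero of `F` would be a null direction of the metric tensor. -/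
lemma apply_ne_zero (h : IsLocalFinsler U F) (hp : p ∈ U) : F p ≠ 0 := by
  intro h0
  have hz : metricTensor F p *ᵥ (fun j => p.2 j) = 0 := by
    funext i
    have h1 := h.euler_dy_sq hp i
    rw [dy_sq (h.differentiableAt hp), h0] at h1
    simp only [Matrix.mulVec, dotProduct, metricTensor, Matrix.of_apply, Fin.sum_univ_two,
      Pi.zero_apply] at h1 ⊢
    rw [dy_dy_comm h.isOpen h.smooth_sq hp i 0, dy_dy_comm h.isOpen h.smooth_sq hp i 1]
    linarith
  have := Matrix.eq_zero_of_mulVec_eq_zero (h.nondegenerate p hp) hz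
  exact h.dir_ne_zero p hp (by ext i; exact congrFun this i)

lemma homog_sprayCoeff (h : IsLocalFinsler U F) (i : Fin 2) : IsHomog U 2 (sprayCoeff F i) := by
  intro p hp t ht
  have hU := h.isOpen
  have h1 : ∀ l, IsHomog U 1 (dy l fun q => F q ^ 2) := fun l => IsHomog.dy hU h.homog_sq l
  have hg : metricTensor F (p.1, t • p.2) = metricTensor F p := by
    ext a b
    have := IsHomog.dy hU (n := 0) (h1 b) a p hp t ht
    simp only [metricTensor, Matrix.of_apply, this]
    ring
  have hc : ∀ l, sprayCovector F l (p.1, t • p.2) = t ^ 2 * sprayCovector F l p := by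
    intro l
    have h2 := fun r => IsHomog.dx hU (h1 l) r p hp t ht
    have h3 := IsHomog.dx hU h.homog_sq l p hp t ht
    simp only [sprayCovector, Fin.sum_univ_two, h2, h3, PiLp.smul_apply, smul_eq_mul]
    ring
  have hs : ∀ q, sprayCoeff F i q =
    1 / 4 * ∑ l, (metricTensor F q)⁻¹ i l * sprayCovector F l q := fun q => rfl
  simp only [hs, hg, hc, Fin.sum_univ_two]
  ring

lemma euler_barthelCoeff (h : IsLocalFinsler U F) (hp : p ∈ U) (i j : Fin 2) :
    ∑ k, p.2 k * berwaldCoeff F i j k p = barthelCoeff F i j p := by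
  have := (IsHomog.dy h.isOpen (n := 1) (h.homog_sprayCoeff i) j).euler hp
    (differentiableAt_of_contDiffOn h.isOpen (h.smooth_barthelCoeff i j) hp)
  rwa [Nat.cast_one, one_mul] at this

/-- The Barthel connection is conservative, `δ_i F² = 0`. Contracting the spray equation with `y`
gives `yʳ ∂F²/∂xʳ = 2 Gʲ ∂F²/∂yʲ`; differentiating this in the direction `yˡ` and subtracting the
spray equation leaves the assertion. -/
lemma dx_sq_eq (h : IsLocalFinsler U F) (hp : p ∈ U) (l : Fin 2) :
    dx l (fun q => F q ^ 2) p = ∑ j, barthelCoeff F j l p * dy j (fun q => F q ^ 2) p := by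
  have hU := h.isOpen
  have hL := h.smooth_sq
  -- the spray equation
  have hspray : ∀ q ∈ U, ∀ l, (∑ r, q.2 r * dx r (dy l fun q => F q ^ 2) q)
      - dx l (fun q => F q ^ 2) q
      = 2 * ∑ j, sprayCoeff F j q * dy l (dy j fun q => F q ^ 2) q := by
    intro q hq l
    have := h.sum_metricTensor_mul_sprayCoeff hq l
    simp only [metricTensor, Matrix.of_apply, sprayCovector, Fin.sum_univ_two] at this ⊢
    linarith
  -- Euler's identity for `∂F²/∂xʳ`
  have hdL : ∀ q ∈ U, ∀ r, ∑ j, q.2 j * dx r (dy j fun q => F q ^ 2) q =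
      2 * dx r (fun q => F q ^ 2) q := by
    intro q hq r
    have := (IsHomog.dx hU h.homog_sq r).euler hq
      (differentiableAt_of_contDiffOn hU (contDiffOn_dx hU hL r) hq)
    simp only [dy_dx_comm hU hL hq] at this
    simpa using this
  -- the spray equation contracted with `y`
  have hcontr : Set.EqOn (fun q => ∑ r, q.2 r * dx r (fun q => F q ^ 2) q)
      (fun q => 2 * ∑ j, sprayCoeff F j q * dy j (fun q => F q ^ 2) q) U := by
    intro q hq
    have a0 := hspray q hq 0
    have a1 := hspray q hq 1
    have b0 := hdL q hq 0
    have b1 := hdL q hq 1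
    have c0 := h.euler_dy_sq hq 0
    have c1 := h.euler_dy_sq hq 1
    simp only [Fin.sum_univ_two] at a0 a1 b0 b1 c0 c1 ⊢
    linear_combination q.2 0 * a0 + q.2 1 * a1 - q.2 0 * b0 - q.2 1 * b1
      + 2 * sprayCoeff F 0 q * c0 + 2 * sprayCoeff F 1 q * c1
  have hd := dy_congr hU hcontr hp l
  have hdir : ∀ r, DifferentiableAt ℝ (fun q : Plane × Plane => q.2 r) p := fun r => by fun_prop
  have hdx : ∀ r, DifferentiableAt ℝ (fun q => dx r (fun q => F q ^ 2) q) p := fun r =>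
    differentiableAt_of_contDiffOn hU (contDiffOn_dx hU hL r) hp
  have hdy : ∀ r, DifferentiableAt ℝ (fun q => dy r (fun q => F q ^ 2) q) p := fun r =>
    differentiableAt_of_contDiffOn hU (contDiffOn_dy hU hL r) hp
  have hG : ∀ r, DifferentiableAt ℝ (fun q => sprayCoeff F r q) p := fun r =>
    differentiableAt_of_contDiffOn hU (h.smooth_sprayCoeff r) hp
  simp only [Fin.sum_univ_two] at hd
  rw [dy_mul_add_mul (hdir 0) (hdx 0) (hdir 1) (hdx 1),
    dy_const_mul 2 (((hG 0).fun_mul (hdy 0)).fun_add ((hG 1).fun_mul (hdy 1))),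
    dy_mul_add_mul (hG 0) (hdy 0) (hG 1) (hdy 1), dy_coord, dy_coord,
    dy_dx_comm hU hL hp, dy_dx_comm hU hL hp] at hd
  have hb : ∀ j, dy l (fun q => sprayCoeff F j q) p = barthelCoeff F j l p := fun j => rfl
  rw [hb, hb] at hd
  have ha := hspray p hp l
  simp only [Fin.sum_univ_two] at ha ⊢
  fin_cases l <;> simp at hd ha ⊢ <;> linarith

/-- A symmetric linear connection whose horizontal derivative annihilates `F²` gives the geodesic
spray of `F`. The hypothesis, contracted with `y`, is differentiated along the fibres only, so that
no regularity of `Γ` in the position is needed. -/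
lemma sprayCoeff_eq_of_dx_sq (h : IsLocalFinsler U F) {Γ : Fin 2 → Fin 2 → Fin 2 → Plane → ℝ}
    (hΓ : ∀ i j k x, Γ i j k x = Γ i k j x)
    (hF : ∀ p ∈ U, ∀ i, dx i (fun q => F q ^ 2) p =
      ∑ j, (∑ k, Γ j i k p.1 * p.2 k) * dy j (fun q => F q ^ 2) p)
    (hp : p ∈ U) (i : Fin 2) :
    sprayCoeff F i p = 1 / 2 * ∑ j, ∑ k, Γ i j k p.1 * p.2 j * p.2 k := by
  have hU := h.isOpen
  have hL := h.smooth_sq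
  refine h.sprayCoeff_eq_of_sum hp (Q := fun i => 1 / 2 * ∑ j, ∑ k, Γ i j k p.1 * p.2 j * p.2 k)
    (fun l => ?_) i
  have hdir : ∀ r, DifferentiableAt ℝ (fun q : Plane × Plane => q.2 r) p := fun r => by fun_prop
  have hdx : ∀ r, DifferentiableAt ℝ (fun q => dx r (fun q => F q ^ 2) q) p := fun r =>
    differentiableAt_of_contDiffOn hU (contDiffOn_dx hU hL r) hp
  have hdy : ∀ r, DifferentiableAt ℝ (fun q => dy r (fun q => F q ^ 2) q) p := fun r =>
    differentiableAt_of_contDiffOn hU (contDiffOn_dy hU hL r) hp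
  have hQ : ∀ a, DifferentiableAt ℝ
      (fun q : Plane × Plane => ∑ j, ∑ k, Γ a j k p.1 * q.2 j * q.2 k) p := fun a => by fun_prop
  -- the contraction of the hypothesis with `y`, with the connection frozen at the position of `p`
  have hd := dy_congr_fiber (i := l) hU hp
    (((hdir 0).fun_mul (hdx 0)).fun_add ((hdir 1).fun_mul (hdx 1)))
    (((hQ 0).fun_mul (hdy 0)).fun_add ((hQ 1).fun_mul (hdy 1)))
    (by
      intro q hq hq1
      have h0 := hF q hq 0
      have h1 := hF q hq 1
      simp only [Fin.sum_univ_two, hq1] at h0 h1 ⊢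
      rw [h0, h1]
      ring)
  rw [dy_mul_add_mul (hdir 0) (hdx 0) (hdir 1) (hdx 1),
    dy_mul_add_mul (hQ 0) (hdy 0) (hQ 1) (hdy 1), dy_coord, dy_coord, dy_dx_comm hU hL hp,
    dy_dx_comm hU hL hp, dy_quadratic _ (fun j k => hΓ 0 j k p.1),
    dy_quadratic _ (fun j k => hΓ 1 j k p.1)] at hd
  have hl := hF p hp l
  simp only [metricTensor, Matrix.of_apply, sprayCovector, Fin.sum_univ_two] at hl hd ⊢
  fin_cases l <;> simp at hl hd ⊢ <;> linarith

section Linear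

variable {Γ : Fin 2 → Fin 2 → Fin 2 → Plane → ℝ} (h : IsLocalFinsler U F)
  (hΓ : ∀ i j k x, Γ i j k x = Γ i k j x)
  (hF : ∀ p ∈ U, ∀ i, dx i (fun q => F q ^ 2) p =
    ∑ j, (∑ k, Γ j i k p.1 * p.2 k) * dy j (fun q => F q ^ 2) p)

include h hΓ hF

lemma barthelCoeff_eq_of_dx_sq (hp : p ∈ U) (i j : Fin 2) :
    barthelCoeff F i j p = ∑ k, Γ i j k p.1 * p.2 k := by
  have hfib : dy j (sprayCoeff F i) p =
      dy j (fun q => 1 / 2 * ∑ j, ∑ k, Γ i j k p.1 * q.2 j * q.2 k) p :=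
    dy_congr_fiber h.isOpen hp
      (differentiableAt_of_contDiffOn h.isOpen (h.smooth_sprayCoeff i) hp) (by fun_prop)
      (fun q hq hq1 => by rw [h.sprayCoeff_eq_of_dx_sq hΓ hF hq, hq1]) j
  rw [barthelCoeff, hfib, dy_const_mul _ (by fun_prop), dy_quadratic _ fun j k => hΓ i j k p.1]
  ring

lemma berwaldCoeff_eq_of_dx_sq (hp : p ∈ U) (i j k : Fin 2) :
    berwaldCoeff F i j k p = Γ i j k p.1 := by
  have hfib : dy k (barthelCoeff F i j) p = dy k (fun q => ∑ k, Γ i j k p.1 * q.2 k) p :=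
    dy_congr_fiber h.isOpen hp
      (differentiableAt_of_contDiffOn h.isOpen (h.smooth_barthelCoeff i j) hp) (by fun_prop)
      (fun q hq hq1 => by rw [h.barthelCoeff_eq_of_dx_sq hΓ hF hq, hq1]) k
  rw [berwaldCoeff, hfib, dy_linear]

lemma berwaldCurv_eq_zero_of_dx_sq (hp : p ∈ U) (i j k l : Fin 2) :
    berwaldCurv F i j k l p = 0 := by
  have hfib : dy l (berwaldCoeff F i j k) p = dy l (fun _ => Γ i j k p.1) p :=
    dy_congr_fiber h.isOpen hp
      (differentiableAt_of_contDiffOn h.isOpen (h.smooth_berwaldCoeff i j k) hp) (by fun_prop)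
      (fun q hq hq1 => by rw [h.berwaldCoeff_eq_of_dx_sq hΓ hF hq, hq1]) l
  rw [berwaldCurv, hfib, dy_const]

end Linear

/-- The frame `(ℓ, m)` is a basis, so that the two h-scalar derivatives determine the horizontal
derivative. -/
lemma hScalars_eq_zero_iff (h : IsLocalFinsler U F) (hp : p ∈ U) (f : Plane × Plane → ℝ) :
    (hScalar1 F f p = 0 ∧ hScalar2 F f p = 0) ↔ ∀ i, horDeriv F i f p = 0 := by
  constructor
  · rintro ⟨h1, h2⟩
    have hF := h.apply_ne_zero hp
    have hdet := h.nondegenerate p hp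
    have he : ∑ i, p.2 i * dy i F p = F p := by
      simpa using h.homog.euler hp (h.differentiableAt hp)
    have hc : frameSign F p * (frameSign F p /
        Real.sqrt (frameSign F p * (metricTensor F p).det)) ≠ 0 := by
      have hs : frameSign F p ≠ 0 := by
        simpa [frameSign, Real.sign_eq_zero_iff] using hdet
      have hpos : 0 < frameSign F p * (metricTensor F p).det := Real.sign_mul_pos_of_ne_zero _ hdet
      exact mul_ne_zero hs (div_ne_zero hs (Real.sqrt_ne_zero'.2 hpos))
    simp only [hScalar1, hScalar2, frameEll, frameM, Fin.sum_univ_two, Matrix.cons_val_zero,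
      Matrix.cons_val_one] at h1 h2 he
    have k1 : horDeriv F 0 f p * p.2 0 + horDeriv F 1 f p * p.2 1 = 0 := by
      field_simp at h1
      linarith
    have k2 : -horDeriv F 0 f p * dy 1 F p + horDeriv F 1 f p * dy 0 F p = 0 := by
      refine (mul_eq_zero.1 ?_).resolve_left hc
      rw [← h2]
      ring
    have r0 : horDeriv F 0 f p * F p = 0 := by
      linear_combination -horDeriv F 0 f p * he + dy 0 F p * k1 - p.2 1 * k2
    have r1 : horDeriv F 1 f p * F p = 0 := by
      linear_combination -horDeriv F 1 f p * he + dy 1 F p * k1 + p.2 0 * k2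
    intro i
    fin_cases i
    · exact (mul_eq_zero.1 r0).resolve_right hF
    · exact (mul_eq_zero.1 r1).resolve_right hF
  · intro h0
    simp [hScalar1, hScalar2, h0]

/-- The Barthel connection is conservative, `δ_i F = 0`. -/
lemma horDeriv_self (h : IsLocalFinsler U F) (hp : p ∈ U) (i : Fin 2) : horDeriv F i F p = 0 := by
  have h1 := h.dx_sq_eq hp i
  simp only [dx_sq (h.differentiableAt hp), dy_sq (h.differentiableAt hp), Fin.sum_univ_two] at h1
  have h2 : 2 * F p * horDeriv F i F p = 0 := by
    simp only [horDeriv, Fin.sum_univ_two]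
    linear_combination h1
  exact (mul_eq_zero.1 h2).resolve_left (by simpa using h.apply_ne_zero hp)

/-- Metrics with the same Barthel connection have the same horizontal derivative, which annihilates
both; the logarithm of their quotient is therefore horizontally constant. -/
lemma horDeriv_eq_zero_of_barthelCoeff_eq (h : IsLocalFinsler U F) {φ : Plane × Plane → ℝ}
    (hφ : ContDiffOn ℝ ∞ φ U) (h' : IsLocalFinsler U fun q => Real.exp (φ q) * F q) (hp : p ∈ U)
    (hN : ∀ i j, barthelCoeff (fun q => Real.exp (φ q) * F q) i j p = barthelCoeff F i j p)
    (i : Fin 2) : horDeriv F i φ p = 0 := by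
  have h1 := h.horDeriv_self hp i
  have h2 := h'.horDeriv_self hp i
  have hφd := differentiableAt_of_contDiffOn h.isOpen hφ hp
  have hFd := h.differentiableAt hp
  have hne := mul_ne_zero (Real.exp_ne_zero (φ p)) (h.apply_ne_zero hp)
  simp only [horDeriv, hN, dx_mul hφd.exp hFd, dy_mul hφd.exp hFd, dx_exp hφd, dy_exp hφd,
    Fin.sum_univ_two] at h1 h2 ⊢
  refine (mul_eq_zero.1 ?_).resolve_left hne
  linear_combination h2 - Real.exp (φ p) * h1

/-- If `φ` is horizontally constant with respect to `F`, then `δ_i` annihilates `(e^φ F)²`. -/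
lemma dx_sq_conformal (h : IsLocalFinsler U F) {φ : Plane × Plane → ℝ} (hφ : ContDiffOn ℝ ∞ φ U)
    (hp : p ∈ U) (i : Fin 2) (h0 : horDeriv F i φ p = 0) :
    dx i (fun q => (Real.exp (φ q) * F q) ^ 2) p =
      ∑ j, barthelCoeff F j i p * dy j (fun q => (Real.exp (φ q) * F q) ^ 2) p := by
  have h1 := h.horDeriv_self hp i
  have hφd := differentiableAt_of_contDiffOn h.isOpen hφ hp
  have hFd := h.differentiableAt hp
  have hm : DifferentiableAt ℝ (fun q => Real.exp (φ q) * F q) p := hφd.exp.mul hFd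
  simp only [dx_sq hm, dy_sq hm, horDeriv, dx_mul hφd.exp hFd, dy_mul hφd.exp hFd, dx_exp hφd,
    dy_exp hφd, Fin.sum_univ_two] at h0 h1 ⊢
  linear_combination 2 * (Real.exp (φ p) * F p) * Real.exp (φ p) * (F p * h0 + h1)

end IsLocalFinsler

/-! ### Charts of the tangent bundle -/

section Charts

variable {M : Type*} [TopologicalSpace M] [ChartedSpace Plane M]
  [IsManifold 𝓘(ℝ, Plane) ∞ M] {e : OpenPartialHomeomorph M Plane}
  {A : Set (TB M)} {F φ : TB M → ℝ}

/-- The canonical identification of the coordinate space with the tangent bundle of the plane. -/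
def planeTangent (p : Plane × Plane) : TB Plane := ⟨p.1, p.2⟩

lemma contMDiff_planeTangent :
    ContMDiff 𝓘(ℝ, Plane × Plane) (𝓘(ℝ, Plane)).tangent ∞ planeTangent := by
  have h := contMDiff_tangentBundleModelSpaceHomeomorph_symm (I := 𝓘(ℝ, Plane)) (n := ∞)
  rw [modelWithCornersSelf_prod]
  exact h

lemma contMDiff_planeTangent_symm :
    ContMDiff (𝓘(ℝ, Plane)).tangent 𝓘(ℝ, Plane × Plane) ∞
      (fun v : TB Plane => ((v.1, v.2) : Plane × Plane)) := by
  have h := contMDiff_tangentBundleModelSpaceHomeomorph (I := 𝓘(ℝ, Plane)) (n := ∞)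
  rw [modelWithCornersSelf_prod]
  exact h

lemma contMDiffOn_tangentOf (he : e ∈ atlas Plane M) :
    ContMDiffOn 𝓘(ℝ, Plane × Plane) (𝓘(ℝ, Plane)).tangent ∞ (tangentOf (M := M) e)
      {p : Plane × Plane | p.1 ∈ e.target} := by
  have h1 := (contMDiffOn_symm_of_mem_maximalAtlas
    (IsManifold.subset_maximalAtlas (I := 𝓘(ℝ, Plane)) (n := ∞) he)).contMDiffOn_tangentMapWithin
    (m := ∞) (by simp) e.open_target.uniqueMDiffOn
  have h2 := h1.comp
    (contMDiff_planeTangent.contMDiffOn (s := {p : Plane × Plane | p.1 ∈ e.target}))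
    (fun p hp => hp)
  refine h2.congr fun p hp => ?_
  simp only [tangentOf, planeTangent, Function.comp, tangentMapWithin]
  rw [mfderivWithin_of_isOpen e.open_target hp]
  rfl

lemma tangentOf_scale (e : OpenPartialHomeomorph M Plane) (p : Plane × Plane) (t : ℝ) :
    tangentOf e (p.1, t • p.2) = scale t (tangentOf e p) := by
  simp only [tangentOf, scale]
  congr 1
  exact map_smul (mfderiv 𝓘(ℝ, Plane) 𝓘(ℝ, Plane) e.symm p.1) t p.2

lemma isOpen_localDom (he : e ∈ atlas Plane M) (hA : IsOpen A) : IsOpen (localDom e A) :=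
  (contMDiffOn_tangentOf he).continuousOn.isOpen_inter_preimage
    (e.open_target.preimage continuous_fst) hA

lemma contDiffOn_localRep (he : e ∈ atlas Plane M) (hF : SmoothOn A F) :
    ContDiffOn ℝ ∞ (localRep e F) (localDom e A) :=
  contMDiffOn_iff_contDiffOn.1
    (ContMDiffOn.comp hF ((contMDiffOn_tangentOf he).mono fun _ hp => hp.1) fun _ hp => hp.2)

lemma dir_ne_zero_of_mem_localDom (hA : IsConicSubbundle A) {p : Plane × Plane}
    (hp : p ∈ localDom e A) : p.2 ≠ 0 := by
  intro h
  refine hA.ne_zero _ hp.2 ?_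
  simp only [tangentOf]
  rw [h]
  exact map_zero (mfderiv 𝓘(ℝ, Plane) 𝓘(ℝ, Plane) e.symm p.1)

lemma scale_mem_localDom (hA : IsConicSubbundle A) {p : Plane × Plane}
    (hp : p ∈ localDom e A) {t : ℝ} (ht : 0 < t) : (p.1, t • p.2) ∈ localDom e A :=
  ⟨hp.1, by rw [tangentOf_scale]; exact hA.scale_mem _ hp.2 t ht⟩

lemma IsConicPseudoFinsler.isLocalFinsler (h : IsConicPseudoFinsler A F)
    (he : e ∈ atlas Plane M) : IsLocalFinsler (localDom e A) (localRep e F) where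
  isOpen := isOpen_localDom he h.conic.isOpen
  scale_mem _ hp _ ht := scale_mem_localDom h.conic hp ht
  dir_ne_zero _ hp := dir_ne_zero_of_mem_localDom h.conic hp
  smooth := contDiffOn_localRep he h.smooth
  homog p hp t ht := by
    simp only [localRep, tangentOf_scale, pow_one]
    exact h.homogeneous _ hp.2 t ht
  nondegenerate := h.nondegenerate e he

lemma mfderiv_symm_bijective (he : e ∈ atlas Plane M) {u : Plane} (hu : u ∈ e.target) :
    Function.Bijective (mfderiv 𝓘(ℝ, Plane) 𝓘(ℝ, Plane) e.symm u) := by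
  have : IsManifold 𝓘(ℝ, Plane) 1 M := IsManifold.of_le (n := ∞) (by simp)
  exact (mdifferentiable_of_mem_atlas he).symm.mfderiv_bijective hu

/-! ### Pseudo-Riemannian metrics and their Levi-Civita connections -/

namespace PseudoRiemannianMetric

variable (a : PseudoRiemannianMetric M)

set_option linter.unusedSectionVars false

lemma coeff_symm (e : OpenPartialHomeomorph M Plane) (u : Plane) (i j : Fin 2) :
    a.coeff e u i j = a.coeff e u j i := a.symm _ _ _

lemma dcoeff_symm (e : OpenPartialHomeomorph M Plane) (k i j : Fin 2) (u : Plane) :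
    a.dcoeff e k i j u = a.dcoeff e k j i u := by
  simp only [dcoeff, a.coeff_symm e _ i j]

lemma christoffel_symm (e : OpenPartialHomeomorph M Plane) (i j k : Fin 2) (u : Plane) :
    a.christoffel e i j k u = a.christoffel e i k j u := by
  simp only [christoffel, a.dcoeff_symm e _ j k, add_comm]

lemma contDiffOn_coeff (he : e ∈ atlas Plane M) (i j : Fin 2) :
    ContDiffOn ℝ ∞ (fun u => a.coeff e u i j) e.target := a.smooth e he i j

lemma differentiableAt_coeff (he : e ∈ atlas Plane M) (i j : Fin 2) {u : Plane}
    (hu : u ∈ e.target) : DifferentiableAt ℝ (fun u => a.coeff e u i j) u :=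
  ((a.contDiffOn_coeff he i j).contDiffAt (e.open_target.mem_nhds hu)).differentiableAt (by simp)

lemma form_eq_sum (e : OpenPartialHomeomorph M Plane) (u y z : Plane) :
    a.form (e.symm u) (mfderiv 𝓘(ℝ, Plane) 𝓘(ℝ, Plane) e.symm u y)
      (mfderiv 𝓘(ℝ, Plane) 𝓘(ℝ, Plane) e.symm u z) =
      ∑ i, ∑ j, a.coeff e u i j * y i * z j := by
  have hexp : ∀ y : Plane, mfderiv 𝓘(ℝ, Plane) 𝓘(ℝ, Plane) e.symm u y =
      y 0 • mfderiv 𝓘(ℝ, Plane) 𝓘(ℝ, Plane) e.symm u (EuclideanSpace.single 0 1 : Plane) +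
      y 1 • mfderiv 𝓘(ℝ, Plane) 𝓘(ℝ, Plane) e.symm u (EuclideanSpace.single 1 1 : Plane) := by
    intro y
    have hy : y = y 0 • (EuclideanSpace.single 0 1 : Plane) +
        y 1 • (EuclideanSpace.single 1 1 : Plane) := by
      ext k
      fin_cases k <;> simp
    conv_lhs => rw [hy]
    exact (map_add (mfderiv 𝓘(ℝ, Plane) 𝓘(ℝ, Plane) e.symm u) _ _).trans
      (congrArg₂ _ (map_smul (mfderiv 𝓘(ℝ, Plane) 𝓘(ℝ, Plane) e.symm u) _ _)
        (map_smul (mfderiv 𝓘(ℝ, Plane) 𝓘(ℝ, Plane) e.symm u) _ _))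
  rw [hexp y, hexp z]
  simp only [map_add, map_smul, LinearMap.add_apply, LinearMap.smul_apply, smul_eq_mul,
    Fin.sum_univ_two, coeff, Matrix.of_apply]
  ring

lemma det_coeff_ne_zero (he : e ∈ atlas Plane M) {u : Plane} (hu : u ∈ e.target) :
    (a.coeff e u).det ≠ 0 := by
  intro h0
  obtain ⟨w, hw, hw0⟩ := Matrix.exists_mulVec_eq_zero_iff.2 h0
  have hbij := mfderiv_symm_bijective he hu
  have hz : mfderiv 𝓘(ℝ, Plane) 𝓘(ℝ, Plane) e.symm u (WithLp.toLp 2 w : Plane) = 0 := by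
    suffices h : ∀ z : Plane, a.form _ (mfderiv 𝓘(ℝ, Plane) 𝓘(ℝ, Plane) e.symm u z)
        (mfderiv 𝓘(ℝ, Plane) 𝓘(ℝ, Plane) e.symm u (WithLp.toLp 2 w : Plane)) = 0 by
      refine a.nondegenerate _ _ fun z => ?_
      obtain ⟨z, rfl⟩ := hbij.2 z
      rw [a.symm]
      exact h z
    intro z
    rw [a.form_eq_sum]
    have h1 := congrFun hw0 0
    have h2 := congrFun hw0 1
    simp only [Matrix.mulVec, dotProduct, Fin.sum_univ_two, Pi.zero_apply] at h1 h2 ⊢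
    linear_combination z 0 * h1 + z 1 * h2
  have := hbij.1 (hz.trans (map_zero (mfderiv 𝓘(ℝ, Plane) 𝓘(ℝ, Plane) e.symm u)).symm)
  exact hw (congrArg WithLp.ofLp (this : (WithLp.toLp 2 w : Plane) = 0))

/-- The Christoffel symbols with the upper index lowered. -/
lemma sum_coeff_mul_christoffel (he : e ∈ atlas Plane M) {u : Plane} (hu : u ∈ e.target)
    (l j k : Fin 2) :
    ∑ i, a.coeff e u l i * a.christoffel e i j k u =
      1 / 2 * (a.dcoeff e j l k u + a.dcoeff e k l j u - a.dcoeff e l j k u) := by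
  have hinv : a.coeff e u * (a.coeff e u)⁻¹ = 1 :=
    Matrix.mul_nonsing_inv _ (isUnit_iff_ne_zero.2 (a.det_coeff_ne_zero he hu))
  have hs : (fun i => a.christoffel e i j k u) = (1 / 2 : ℝ) • (a.coeff e u)⁻¹ *ᵥ
      fun l => a.dcoeff e j l k u + a.dcoeff e k l j u - a.dcoeff e l j k u := by
    funext i
    simp only [christoffel, Matrix.mulVec, dotProduct, Pi.smul_apply, smul_eq_mul]
  have : a.coeff e u *ᵥ (fun i => a.christoffel e i j k u) = (1 / 2 : ℝ) •
      fun l => a.dcoeff e j l k u + a.dcoeff e k l j u - a.dcoeff e l j k u := by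
    rw [hs, Matrix.mulVec_smul, Matrix.mulVec_mulVec, hinv, Matrix.one_mulVec]
  simpa [Matrix.mulVec, dotProduct] using congrFun this l

end PseudoRiemannianMetric

variable {a : PseudoRiemannianMetric M}

/-- The Levi-Civita connection of `a` is conservative for the metric `F² = a_ij yⁱ yʲ`. -/
lemma IsInducedBy.dx_sq_eq (h : IsInducedBy A F a) (hA : IsOpen A) (he : e ∈ atlas Plane M)
    {p : Plane × Plane} (hp : p ∈ localDom e A) (hF : DifferentiableAt ℝ (localRep e F) p)
    (i : Fin 2) :
    dx i (fun q => localRep e F q ^ 2) p =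
      ∑ j, (∑ k, a.christoffel e j i k p.1 * p.2 k) * dy j (fun q => localRep e F q ^ 2) p := by
  have hU := isOpen_localDom he hA
  have hL : Set.EqOn (fun q => localRep e F q ^ 2)
      (fun q => ∑ j, ∑ k, a.coeff e q.1 j k * q.2 j * q.2 k) (localDom e A) := fun q hq =>
    (h _ hq.2).trans (a.form_eq_sum e q.1 q.2 q.2)
  have hdy : ∀ j, dy j (fun q => localRep e F q ^ 2) p = 2 * ∑ k, a.coeff e p.1 j k * p.2 k := by
    intro j
    rw [← dy_quadratic (a.coeff e p.1) (a.coeff_symm e p.1)]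
    exact dy_congr_fiber hU hp (hF.pow 2) (by fun_prop) (fun q hq hq1 => by
      rw [← hq1]; exact hL hq) j
  have hdx : dx i (fun q => localRep e F q ^ 2) p =
      ∑ j, ∑ k, a.dcoeff e i j k p.1 * p.2 j * p.2 k := by
    have hc : ∀ j k, DifferentiableAt ℝ (fun q : Plane × Plane => a.coeff e q.1 j k) p :=
      fun j k => DifferentiableAt.comp p (a.differentiableAt_coeff he j k hp.1)
        differentiableAt_fst
    have hc' := fun j k => a.differentiableAt_coeff he j k hp.1
    have hy : ∀ j, DifferentiableAt ℝ (fun q : Plane × Plane => q.2 j) p := fun j => by fun_prop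
    have hterm : ∀ j k, dx i (fun q => a.coeff e q.1 j k * q.2 j * q.2 k) p =
        a.dcoeff e i j k p.1 * p.2 j * p.2 k := by
      intro j k
      rw [dx_mul ((hc j k).fun_mul (hy j)) (hy k), dx_mul (hc j k) (hy j), dx_coord, dx_coord,
        dx_comp_fst (b := fun u => a.coeff e u j k) (hc' j k)]
      simp only [PseudoRiemannianMetric.dcoeff]
      ring
    have hd : ∀ j k, DifferentiableAt ℝ (fun q => a.coeff e q.1 j k * q.2 j * q.2 k) p :=
      fun j k => ((hc j k).fun_mul (hy j)).fun_mul (hy k)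
    rw [dx_congr hU hL hp]
    simp only [Fin.sum_univ_two]
    rw [dx_add ((hd 0 0).fun_add (hd 0 1)) ((hd 1 0).fun_add (hd 1 1)), dx_add (hd 0 0) (hd 0 1),
      dx_add (hd 1 0) (hd 1 1), hterm, hterm, hterm, hterm]
  have hchr := fun l k => a.sum_coeff_mul_christoffel he hp.1 l i k
  have hs := a.coeff_symm e p.1 0 1
  have hds := fun k => a.dcoeff_symm e k 0 1 p.1
  rw [hdx]
  simp only [hdy, Fin.sum_univ_two] at hchr ⊢
  have h00 := hchr 0 0
  have h01 := hchr 0 1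
  have h10 := hchr 1 0
  have h11 := hchr 1 1
  rw [← hs] at h10 h11
  rw [← hs]
  have e0 := hds 0
  have e1 := hds 1
  clear hchr hdy hdx hds hL
  fin_cases i <;> simp only [Fin.zero_eta, Fin.mk_one, Fin.isValue] at * <;>
    rw [← e0, ← e1] at * <;>
    linear_combination (-2) * p.2 0 * p.2 0 * h00 - 2 * p.2 0 * p.2 1 * h01
      - 2 * p.2 1 * p.2 0 * h10 - 2 * p.2 1 * p.2 1 * h11

/-- The criterion for a fixed metric `a` inducing `F`. The Barthel connection of `F` is
`Γⁱ_jk yᵏ` with the Christoffel symbols `Γ` of `a`. If the Berwald connection of `e^φ F` is `Γ`,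
then by homogeneity the two metrics have the same Barthel connection, which annihilates both;
conversely a connection annihilating `F` and `φ` annihilates `e^φ F` and is thus the one of `e^φ F`. -/
lemma hasLeviCivita_conformalChange_iff (hF : IsConicPseudoFinsler A F) (ha : IsInducedBy A F a)
    (hφ : SmoothOn A φ) (hF' : IsConicPseudoFinsler A (conformalChange φ F)) :
    HasLeviCivita A (conformalChange φ F) a ↔ IsHorizontallyConstant A F φ := by
  have key : ∀ e ∈ atlas Plane M, ∀ p ∈ localDom e A, ∀ i j,
      barthelCoeff (localRep e F) i j p = ∑ k, a.christoffel e i j k p.1 * p.2 k := by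
    intro e he p hp i j
    have hl := hF.isLocalFinsler he
    exact hl.barthelCoeff_eq_of_dx_sq (a.christoffel_symm e)
      (fun q hq => ha.dx_sq_eq hF.conic.isOpen he hq (hl.differentiableAt hq)) hp i j
  constructor
  · intro h e he p hp
    have hl := hF.isLocalFinsler he
    have hl' := hF'.isLocalFinsler he
    refine hl.horDeriv_eq_zero_of_barthelCoeff_eq (contDiffOn_localRep he hφ) hl' hp fun i j => ?_
    rw [key e he p hp]
    refine (hl'.euler_barthelCoeff hp i j).symm.trans ?_
    exact Finset.sum_congr rfl fun k _ => by rw [h e he p hp, mul_comm]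
  · intro h e he p hp
    have hl := hF.isLocalFinsler he
    have hl' := hF'.isLocalFinsler he
    refine hl'.berwaldCoeff_eq_of_dx_sq (a.christoffel_symm e) (fun q hq i => ?_) hp
    simp only [← key e he q hq]
    exact hl.dx_sq_conformal (contDiffOn_localRep he hφ) hq i (h e he q hq i)

lemma hScalarsVanish_iff (hF : IsConicPseudoFinsler A F) :
    HScalarsVanish A F φ ↔ IsHorizontallyConstant A F φ :=
  forall₂_congr fun _ he => forall₂_congr fun _ hp =>
    (hF.isLocalFinsler he).hScalars_eq_zero_iff hp _

lemma isRiemannMetrizableBy_iff (hF : IsConicPseudoRiemannian A F) (hφ : SmoothOn A φ)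
    (hF' : IsConicPseudoFinsler A (conformalChange φ F)) :
    IsRiemannMetrizableBy A (conformalChange φ F) F ↔ IsHorizontallyConstant A F φ := by
  constructor
  · rintro ⟨a, ha, hLC⟩
    exact (hasLeviCivita_conformalChange_iff hF.finsler ha hφ hF').1 hLC
  · intro h
    obtain ⟨a, ha⟩ := hF.induced
    exact ⟨a, ha, (hasLeviCivita_conformalChange_iff hF.finsler ha hφ hF').2 h⟩

end Charts

/-! ### The coordinates of the example -/

lemma mem_exM {x : Plane} : x ∈ exM ↔ 0 < x 1 ∧ 4 * (x 0 * x 1) < 1 := Iff.rfl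

lemma nonempty_exM : Nonempty exM := ⟨⟨EuclideanSpace.single 1 1, by simp [mem_exM]⟩⟩

section ExampleCharts

variable {e : OpenPartialHomeomorph exM Plane} {u : Plane} {p : Plane × Plane}

/-- The atlas of an open subset of the plane consists of the inclusion alone. -/
lemma exM_chart_apply (he : e ∈ atlas Plane exM) (x : exM) : e x = x := by
  obtain ⟨x', rfl⟩ := TopologicalSpace.Opens.chart_eq nonempty_exM he
  rfl

lemma exM_chart_source (he : e ∈ atlas Plane exM) : e.source = Set.univ := by
  obtain ⟨x', rfl⟩ := TopologicalSpace.Opens.chart_eq nonempty_exM he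
  simp [chartAt_self_eq]

lemma exM_chart_symm (he : e ∈ atlas Plane exM) (hu : u ∈ e.target) :
    ((e.symm u : exM) : Plane) = u := by
  rw [← exM_chart_apply he, e.right_inv hu]

lemma exM_chart_target (he : e ∈ atlas Plane exM) : e.target = exM := by
  ext u
  constructor
  · intro hu
    rw [← exM_chart_symm he hu]
    exact (e.symm u).2
  · intro hu
    have := e.map_source (x := ⟨u, hu⟩) (by rw [exM_chart_source he]; trivial)
    rwa [exM_chart_apply he] at this

lemma exX_tangentOf (he : e ∈ atlas Plane exM) (hp : p.1 ∈ e.target) :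
    exX (tangentOf e p) = p.1 := exM_chart_symm he hp

lemma mfderiv_val_mfderiv_symm (he : e ∈ atlas Plane exM) (hu : u ∈ e.target) (y : Plane) :
    mfderiv 𝓘(ℝ, Plane) 𝓘(ℝ, Plane) (Subtype.val : exM → Plane) (e.symm u)
      (mfderiv 𝓘(ℝ, Plane) 𝓘(ℝ, Plane) e.symm u y) = y := by
  have hs : MDifferentiableAt 𝓘(ℝ, Plane) 𝓘(ℝ, Plane) e.symm u :=
    (mdifferentiable_of_mem_atlas he).mdifferentiableAt_symm hu
  have hv : MDifferentiableAt 𝓘(ℝ, Plane) 𝓘(ℝ, Plane) (Subtype.val : exM → Plane) (e.symm u) :=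
    (contMDiff_subtype_val (n := 1)).mdifferentiableAt (by simp)
  have hid : (Subtype.val : exM → Plane) ∘ e.symm =ᶠ[nhds u] id := by
    filter_upwards [e.open_target.mem_nhds hu] with w hw using exM_chart_symm he hw
  have h := mfderiv_comp u hv hs
  rw [hid.mfderiv_eq, mfderiv_id] at h
  exact (congrArg (fun l : Plane →L[ℝ] Plane => l y) h).symm

lemma exY_tangentOf (he : e ∈ atlas Plane exM) (hp : p.1 ∈ e.target) :
    exY (tangentOf e p) = p.2 := mfderiv_val_mfderiv_symm he hp p.2

lemma exX_scale (t : ℝ) (v : TB exM) : exX (scale t v) = exX v := rfl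

lemma exY_scale (t : ℝ) (v : TB exM) : exY (scale t v) = t • exY v :=
  map_smul (mfderiv 𝓘(ℝ, Plane) 𝓘(ℝ, Plane) (Subtype.val : exM → Plane) v.1) t v.2

lemma contMDiff_exX_exY : ContMDiff (𝓘(ℝ, Plane)).tangent 𝓘(ℝ, Plane × Plane) ∞
    (fun v : TB exM => (exX v, exY v)) :=
  contMDiff_planeTangent_symm.comp
    ((contMDiff_subtype_val (n := ∞)).contMDiff_tangentMap (m := ∞) (by simp))

end ExampleCharts

/-- The coordinate domain of the example. As for the definitions of the example, the comments
number the coordinates from one: `(x₁, x₂; y₁, y₂)` are `x 0, x 1, y 0, y 1`. -/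
def exDom : Set (Plane × Plane) :=
  {p | p.1 ∈ exM ∧ 0 < p.2 1 ∧ 0 < 2 * p.1 1 ^ 2 * p.2 0 + exC p.1 * p.2 1}

/-- The coefficient `b = c / x₂²`, in terms of which `F² = 2 y₁ y₂ + b y₂²`. -/
noncomputable def exB (x : Plane) : ℝ := exC x / x 1 ^ 2

/-- The derivative `∂b/∂x₁`. -/
noncomputable def exDB (x : Plane) : ℝ := -2 * (1 + (Real.sqrt (1 - 4 * x 0 * x 1))⁻¹) / x 1

/-- The one-form `β = 2 y₁ + b y₂`. -/
noncomputable def exBeta (p : Plane × Plane) : ℝ := 2 * p.2 0 + exB p.1 * p.2 1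

section ExampleCoefficient

variable {x : Plane}

lemma exM_disc_pos (hx : x ∈ exM) : 0 < 1 - 4 * x 0 * x 1 := by
  have := hx.2
  linarith

lemma contDiffOn_exB : ContDiffOn ℝ ∞ exB exM := by
  unfold exB exC
  refine ContDiffOn.div (ContDiffOn.add (by fun_prop) (ContDiffOn.sqrt (by fun_prop) ?_))
    (by fun_prop) ?_
  · exact fun x hx => (exM_disc_pos hx).ne'
  · exact fun x hx => pow_ne_zero _ hx.1.ne'

lemma differentiableAt_exB (hx : x ∈ exM) : DifferentiableAt ℝ exB x :=
  (contDiffOn_exB.contDiffAt (exM.isOpen.mem_nhds hx)).differentiableAt (by simp)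

lemma differentiableAt_exDB (hx : x ∈ exM) : DifferentiableAt ℝ exDB x := by
  have h1 := (exM_disc_pos hx).ne'
  have h2 := hx.1.ne'
  have h3 := Real.sqrt_ne_zero'.2 (exM_disc_pos hx)
  unfold exDB
  fun_prop (disch := assumption)

lemma fderiv_apply_single_eq {f : Plane → ℝ} (hf : DifferentiableAt ℝ f x) (i : Fin 2) {f' : ℝ}
    (h : HasDerivAt (fun t : ℝ => f (x + t • EuclideanSpace.single i 1)) f' 0) :
    fderiv ℝ f x (EuclideanSpace.single i 1) = f' :=
  (hf.hasFDerivAt.hasLineDerivAt (EuclideanSpace.single i 1)).unique h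

lemma hasDerivAt_exM_sqrt (hx : x ∈ exM) :
    HasDerivAt (fun t : ℝ => Real.sqrt (1 - 4 * (x 0 + t) * x 1))
      (-2 * x 1 * (Real.sqrt (1 - 4 * x 0 * x 1))⁻¹) 0 := by
  have hl : HasDerivAt (fun t : ℝ => 1 - 4 * (x 0 + t) * x 1) (-(4 * 1 * x 1)) 0 :=
    ((((hasDerivAt_id (0 : ℝ)).const_add (x 0)).const_mul 4).mul_const (x 1)).const_sub 1
  convert hl.sqrt (by simpa using (exM_disc_pos hx).ne') using 1
  simp only [add_zero]
  have := Real.sqrt_ne_zero'.2 (exM_disc_pos hx)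
  field_simp
  ring

lemma fderiv_exB (hx : x ∈ exM) : fderiv ℝ exB x (EuclideanSpace.single 0 1) = exDB x := by
  refine fderiv_apply_single_eq (differentiableAt_exB hx) 0 ?_
  have hl : HasDerivAt (fun t : ℝ => 1 - 2 * (x 0 + t) * x 1) (-(2 * 1 * x 1)) 0 :=
    ((((hasDerivAt_id (0 : ℝ)).const_add (x 0)).const_mul 2).mul_const (x 1)).const_sub 1
  have h := (hl.add (hasDerivAt_exM_sqrt hx)).div_const (x 1 ^ 2)
  have hx1 := hx.1.ne'
  refine (h.congr_deriv ?_).congr_of_eventuallyEq (.of_forall fun t => ?_)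
  · have := Real.sqrt_ne_zero'.2 (exM_disc_pos hx)
    unfold exDB
    field_simp
    ring
  · simp [exB, exC]

lemma fderiv_exDB_ne_zero (hx : x ∈ exM) :
    fderiv ℝ exDB x (EuclideanSpace.single 0 1) ≠ 0 := by
  have hs := Real.sqrt_ne_zero'.2 (exM_disc_pos hx)
  have hx1 := hx.1.ne'
  have hs0 : Real.sqrt (1 - 4 * (x 0 + 0) * x 1) ≠ 0 := by simpa using hs
  have h := ((((hasDerivAt_exM_sqrt hx).inv hs0).const_add 1).const_mul (-2)).div_const (x 1)
  rw [fderiv_apply_single_eq (differentiableAt_exDB hx) 0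
    (h.congr_of_eventuallyEq (.of_forall fun t => by simp [exDB]))]
  simp only [add_zero]
  simp [hs, hx1]

lemma exDB_ne_zero (hx : x ∈ exM) : exDB x ≠ 0 := by
  have hs := Real.sqrt_pos.2 (exM_disc_pos hx)
  have hx1 := hx.1
  unfold exDB
  have : 0 < 2 * (1 + (Real.sqrt (1 - 4 * x 0 * x 1))⁻¹) / x 1 := by positivity
  have h2 : -2 * (1 + (Real.sqrt (1 - 4 * x 0 * x 1))⁻¹) / x 1 =
    -(2 * (1 + (Real.sqrt (1 - 4 * x 0 * x 1))⁻¹) / x 1) := by ring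
  rw [h2]
  exact neg_ne_zero.2 this.ne'

end ExampleCoefficient

section ExampleDomain

variable {p : Plane × Plane}

lemma exBeta_pos (hp : p ∈ exDom) : 0 < exBeta p := by
  have hx := hp.1.1
  have : exBeta p = (2 * p.1 1 ^ 2 * p.2 0 + exC p.1 * p.2 1) / p.1 1 ^ 2 := by
    unfold exBeta exB
    field_simp
  rw [this]
  exact div_pos hp.2.2 (by positivity)

lemma exDom_sub : exDom ⊆ {p : Plane × Plane | p.1 ∈ exM} := fun _ hp => hp.1

lemma contDiffOn_exB_fst : ContDiffOn ℝ ∞ (fun q : Plane × Plane => exB q.1) {p | p.1 ∈ exM} :=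
  contDiffOn_exB.comp contDiff_fst.contDiffOn fun _ hp => hp

lemma contDiffOn_exBeta : ContDiffOn ℝ ∞ exBeta {p | p.1 ∈ exM} := by
  have h0 : ContDiff ℝ ∞ (fun q : Plane × Plane => 2 * q.2 0) := by fun_prop
  exact h0.contDiffOn.add (contDiffOn_exB_fst.mul (contDiff_dir 1).contDiffOn)

lemma exDom_eq :
    exDom = {p : Plane × Plane | p.1 ∈ exM} ∩ exBeta ⁻¹' Set.Ioi 0 ∩ {p | 0 < p.2 1} := by
  ext p
  constructor
  · exact fun hp => ⟨⟨hp.1, exBeta_pos hp⟩, hp.2.1⟩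
  · rintro ⟨⟨h1, h2⟩, h3⟩
    refine ⟨h1, h3, ?_⟩
    have hx := h1.1
    have : 2 * p.1 1 ^ 2 * p.2 0 + exC p.1 * p.2 1 = p.1 1 ^ 2 * exBeta p := by
      unfold exBeta exB
      field_simp
    rw [this]
    exact mul_pos (by positivity) h2

lemma isOpen_exDom : IsOpen exDom := by
  rw [exDom_eq]
  refine IsOpen.inter (contDiffOn_exBeta.continuousOn.isOpen_inter_preimage ?_ isOpen_Ioi) ?_
  · exact exM.isOpen.preimage continuous_fst
  · exact isOpen_lt continuous_const (by fun_prop)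

lemma localDom_exA {e : OpenPartialHomeomorph exM Plane} (he : e ∈ atlas Plane exM) :
    localDom e exA = exDom := by
  ext p
  simp only [localDom, exA, exDom, Set.mem_ofPred_eq]
  constructor
  · rintro ⟨h1, h2⟩
    rw [exX_tangentOf he h1, exY_tangentOf he h1] at h2
    rw [exM_chart_target he] at h1
    exact ⟨h1, h2⟩
  · rintro ⟨h1, h2⟩
    have h1' : p.1 ∈ e.target := by rw [exM_chart_target he]; exact h1
    rw [exX_tangentOf he h1', exY_tangentOf he h1']
    exact ⟨h1', h2⟩

lemma mem_exDom_of_mem_exA {v : TB exM} (hv : v ∈ exA) : (exX v, exY v) ∈ exDom := ⟨v.1.2, hv⟩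

end ExampleDomain

/-! ### The metrics of the example in coordinates -/

/-- The Levi-Civita connection of `2 dx₁ dx₂ + b dx₂²`. -/
noncomputable def exGammaF (i j k : Fin 2) (x : Plane) : ℝ :=
  ![!![0, exDB x / 2;
      exDB x / 2, (fderiv ℝ exB x (EuclideanSpace.single 1 1) + exB x * exDB x) / 2],
    !![0, 0; 0, -exDB x / 2]] i j k

/-- The torsion-free connection `∇` with `∇β = θ ⊗ β` and `∇ dx₂ = 2 θ ⊗ dx₂` for
`θ = -½ (∂b/∂x₁) dx₂`. It preserves `β² / dx₂`. -/
noncomputable def exGamma (i j k : Fin 2) (x : Plane) : ℝ :=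
  ![!![0, exDB x / 2;
      exDB x / 2, fderiv ℝ exB x (EuclideanSpace.single 1 1) / 2 - exB x * exDB x / 4],
    !![0, 0; 0, exDB x]] i j k

lemma exGammaF_symm (i j k : Fin 2) (x : Plane) : exGammaF i j k x = exGammaF i k j x := by
  fin_cases i <;> fin_cases j <;> fin_cases k <;> rfl

lemma exGamma_symm (i j k : Fin 2) (x : Plane) : exGamma i j k x = exGamma i k j x := by
  fin_cases i <;> fin_cases j <;> fin_cases k <;> rfl

section ExampleCalculus

variable {p : Plane × Plane}

lemma differentiableAt_exBeta (hp : p ∈ exDom) : DifferentiableAt ℝ exBeta p :=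
  differentiableAt_of_contDiffOn isOpen_exDom (contDiffOn_exBeta.mono exDom_sub) hp

lemma differentiableAt_exB_fst (hp : p ∈ exDom) :
    DifferentiableAt ℝ (fun q : Plane × Plane => exB q.1) p :=
  differentiableAt_of_contDiffOn isOpen_exDom (contDiffOn_exB_fst.mono exDom_sub) hp

lemma dy_exBeta (hp : p ∈ exDom) (i : Fin 2) : dy i exBeta p = ![2, exB p.1] i := by
  have hb := differentiableAt_exB_fst hp
  have : exBeta = fun q => 2 * q.2 0 + exB q.1 * q.2 1 := rfl
  rw [this, dy_mul_add_mul (by fun_prop) (by fun_prop) hb (by fun_prop), dy_coord, dy_coord,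
    dy_const, dy_comp_fst (differentiableAt_exB hp.1)]
  fin_cases i <;> simp

lemma dx_exBeta (hp : p ∈ exDom) (i : Fin 2) :
    dx i exBeta p = fderiv ℝ exB p.1 (EuclideanSpace.single i 1) * p.2 1 := by
  have hb := differentiableAt_exB_fst hp
  have h2 : DifferentiableAt ℝ (fun q : Plane × Plane => q.2 1) p := by fun_prop
  have : exBeta = fun q => 2 * q.2 0 + exB q.1 * q.2 1 := rfl
  rw [this, dx_add (by fun_prop) (hb.fun_mul h2), dx_mul hb h2, dx_coord,
    dx_comp_fst (differentiableAt_exB hp.1), dx_comp_snd (b := fun y => 2 * y 0) (by fun_prop)]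
  ring

lemma dy_exBeta_pow_mul (hp : p ∈ exDom) (c : ℝ) (m n : ℤ) (i : Fin 2) :
    dy i (fun q => c * (exBeta q ^ m * q.2 1 ^ n)) p =
      c * (m * exBeta p ^ (m - 1) * p.2 1 ^ n * ![2, exB p.1] i +
        exBeta p ^ m * (n * p.2 1 ^ (n - 1)) * ![0, 1] i) := by
  have hβ := differentiableAt_exBeta hp
  have hy : DifferentiableAt ℝ (fun q : Plane × Plane => q.2 1) p := by fun_prop
  have h1 := hasDerivAt_zpow m (exBeta p) (.inl (exBeta_pos hp).ne')
  have h2 := hasDerivAt_zpow n (p.2 1) (.inl hp.2.1.ne')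
  have d1 : DifferentiableAt ℝ (fun q => exBeta q ^ m) p :=
    h1.differentiableAt.comp p hβ
  have d2 : DifferentiableAt ℝ (fun q : Plane × Plane => q.2 1 ^ n) p :=
    DifferentiableAt.comp p (f := fun q : Plane × Plane => q.2 1) h2.differentiableAt hy
  rw [dy_const_mul c (d1.fun_mul d2), dy_mul d1 d2, dy_comp (g := fun s => s ^ m) h1 hβ,
    dy_comp (g := fun s => s ^ n) h2 hy, dy_exBeta hp, dy_coord]
  congr 1
  fin_cases i <;> simp <;> ring

lemma dx_exBeta_pow_mul (hp : p ∈ exDom) (c : ℝ) (m n : ℤ) (i : Fin 2) :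
    dx i (fun q => c * (exBeta q ^ m * q.2 1 ^ n)) p =
      c * (m * exBeta p ^ (m - 1) * p.2 1 ^ (n + 1) *
        fderiv ℝ exB p.1 (EuclideanSpace.single i 1)) := by
  have hβ := differentiableAt_exBeta hp
  have hy : DifferentiableAt ℝ (fun q : Plane × Plane => q.2 1) p := by fun_prop
  have h1 := hasDerivAt_zpow m (exBeta p) (.inl (exBeta_pos hp).ne')
  have h2 := hasDerivAt_zpow n (p.2 1) (.inl hp.2.1.ne')
  have d1 : DifferentiableAt ℝ (fun q => exBeta q ^ m) p :=
    h1.differentiableAt.comp p hβ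
  have d2 : DifferentiableAt ℝ (fun q : Plane × Plane => q.2 1 ^ n) p :=
    DifferentiableAt.comp p (f := fun q : Plane × Plane => q.2 1) h2.differentiableAt hy
  rw [dx_mul (by fun_prop) (d1.fun_mul d2), dx_mul d1 d2, dx_comp (g := fun s => s ^ m) h1 hβ,
    dx_comp (g := fun s => s ^ n) h2 hy, dx_exBeta hp, dx_coord,
    dx_comp_snd (b := fun _ => c) (by fun_prop), zpow_add_one₀ hp.2.1.ne']
  ring

lemma differentiableAt_exBeta_pow_mul (hp : p ∈ exDom) (c : ℝ) (m n : ℤ) :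
    DifferentiableAt ℝ (fun q => c * (exBeta q ^ m * q.2 1 ^ n)) p := by
  have hβ := differentiableAt_exBeta hp
  have hy : DifferentiableAt ℝ (fun q : Plane × Plane => q.2 1) p := by fun_prop
  exact ((hβ.zpow (.inl (exBeta_pos hp).ne')).mul (hy.zpow (.inl hp.2.1.ne'))).const_mul c

/-- Directional derivatives of `b(x) (c βᵐ y₂ⁿ) + c' βᵏ y₂ˡ`. -/
lemma dy_exB_mul_add (hp : p ∈ exDom) (c c' : ℝ) (m n k l : ℤ) (i : Fin 2) :
    dy i (fun q => exB q.1 * (c * (exBeta q ^ m * q.2 1 ^ n))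
      + c' * (exBeta q ^ k * q.2 1 ^ l)) p =
      exB p.1 * dy i (fun q => c * (exBeta q ^ m * q.2 1 ^ n)) p +
        dy i (fun q => c' * (exBeta q ^ k * q.2 1 ^ l)) p := by
  have hb := differentiableAt_exB_fst hp
  rw [dy_add (hb.fun_mul (differentiableAt_exBeta_pow_mul hp c m n))
    (differentiableAt_exBeta_pow_mul hp c' k l),
    dy_mul hb (differentiableAt_exBeta_pow_mul hp c m n), dy_comp_fst (differentiableAt_exB hp.1)]
  ring

section Riemannian

variable {G : Plane × Plane → ℝ} (hG : ∀ q ∈ exDom, G q ^ 2 = q.2 1 * exBeta q)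

include hG

/-- The square of `F` in the form of a monomial in `β` and `y₂`. Only the identity `G² = y₂ β` on
the coordinate domain is assumed of `G`, since the expression of `F` in a chart is unspecified outside
of it. -/
lemma exF_sq_eqOn : Set.EqOn (fun q => G q ^ 2)
    (fun q => 1 * (exBeta q ^ (1 : ℤ) * q.2 1 ^ (1 : ℤ))) exDom := by
  intro q hq
  simp only [hG q hq, zpow_one]
  ring

lemma dy_exF_sq (hp : p ∈ exDom) (i : Fin 2) :
    dy i (fun q => G q ^ 2) p = ![2 * p.2 1, exBeta p + exB p.1 * p.2 1] i := by
  rw [dy_congr isOpen_exDom (exF_sq_eqOn hG) hp, dy_exBeta_pow_mul hp]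
  fin_cases i <;> simp <;> ring

lemma metricTensor_exF (hp : p ∈ exDom) : metricTensor G p = !![0, 1; 1, exB p.1] := by
  have h0 : Set.EqOn (dy 0 fun q => G q ^ 2)
      (fun q => 2 * (exBeta q ^ (0 : ℤ) * q.2 1 ^ (1 : ℤ))) exDom := by
    intro q hq
    rw [dy_exF_sq hG hq]
    simp
  have h1 : Set.EqOn (dy 1 fun q => G q ^ 2)
      (fun q => exB q.1 * (1 * (exBeta q ^ (0 : ℤ) * q.2 1 ^ (1 : ℤ)))
        + 1 * (exBeta q ^ (1 : ℤ) * q.2 1 ^ (0 : ℤ))) exDom := by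
    intro q hq
    rw [dy_exF_sq hG hq]
    simp
    ring
  have e0 := dy_congr isOpen_exDom h0 hp
  have e1 := dy_congr isOpen_exDom h1 hp
  ext i j
  simp only [metricTensor, Matrix.of_apply]
  fin_cases j
  · simp only [Fin.zero_eta]
    rw [e0, dy_exBeta_pow_mul hp]
    fin_cases i <;> simp
  · simp only [Fin.mk_one]
    rw [e1, dy_exB_mul_add hp, dy_exBeta_pow_mul hp, dy_exBeta_pow_mul hp]
    fin_cases i
    · simp
    · simp
      ring

lemma det_metricTensor_exF (hp : p ∈ exDom) : (metricTensor G p).det = -1 := by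
  simp [metricTensor_exF hG hp, Matrix.det_fin_two]

lemma frameSign_exF (hp : p ∈ exDom) : frameSign G p = -1 := by
  simp [frameSign, det_metricTensor_exF hG hp, Real.sign_of_neg]

lemma exF_ne_zero (hp : p ∈ exDom) : G p ≠ 0 := by
  have h := hG p hp
  have : 0 < p.2 1 * exBeta p := mul_pos hp.2.1 (exBeta_pos hp)
  intro h0
  rw [h0] at h
  linarith

/-- The vector `F m` has the components `(y₁ + b y₂, -y₂)`. -/
lemma mul_frameM_exF (hGd : DifferentiableAt ℝ G p) (hp : p ∈ exDom) (i : Fin 2) :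
    G p * frameM G i p = ![p.2 0 + exB p.1 * p.2 1, -p.2 1] i := by
  have h0 := dy_exF_sq hG hp 0
  have h1 := dy_exF_sq hG hp 1
  rw [dy_sq hGd] at h0 h1
  simp only [exBeta, Matrix.cons_val_zero, Matrix.cons_val_one] at h0 h1
  simp only [frameM, frameSign_exF hG hp, det_metricTensor_exF hG hp]
  fin_cases i <;> simp <;> linarith

/-- The connection `exGammaF` annihilates `F²`. -/
lemma dx_exF_sq_eq (hp : p ∈ exDom) (i : Fin 2) :
    dx i (fun q => G q ^ 2) p =
      ∑ j, (∑ k, exGammaF j i k p.1 * p.2 k) * dy j (fun q => G q ^ 2) p := by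
  have hy := hp.2.1.ne'
  rw [dx_congr isOpen_exDom (exF_sq_eqOn hG) hp, dx_exBeta_pow_mul hp]
  simp only [Fin.sum_univ_two, dy_exF_sq hG hp, exGammaF, exBeta]
  fin_cases i
  · simp [fderiv_exB hp.1]
    norm_cast
    ring
  · simp
    norm_cast
    ring

end Riemannian

section Berwald

variable {H : Plane × Plane → ℝ}
  (hH : ∀ q ∈ exDom, H q ^ 2 = 1 * (exBeta q ^ (4 : ℤ) * q.2 1 ^ (-2 : ℤ)))

include hH

lemma dy_exF'_sq (hp : p ∈ exDom) (i : Fin 2) :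
    dy i (fun q => H q ^ 2) p =
      ![8 * (exBeta p ^ (3 : ℤ) * p.2 1 ^ (-2 : ℤ)),
        exB p.1 * (4 * (exBeta p ^ (3 : ℤ) * p.2 1 ^ (-2 : ℤ))) +
          -2 * (exBeta p ^ (4 : ℤ) * p.2 1 ^ (-3 : ℤ))] i := by
  rw [dy_congr isOpen_exDom hH hp, dy_exBeta_pow_mul hp]
  fin_cases i <;> norm_num <;> ring

/-- The metric tensor of `e^φ F = β² / y₂` is nondegenerate. -/
lemma det_metricTensor_exF' (hp : p ∈ exDom) :
    (metricTensor H p).det = 8 * (exBeta p ^ 6 / p.2 1 ^ 6) := by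
  have h0 : Set.EqOn (dy 0 fun q => H q ^ 2)
      (fun q => 8 * (exBeta q ^ (3 : ℤ) * q.2 1 ^ (-2 : ℤ))) exDom := fun q hq => by
    simp [dy_exF'_sq hH hq]
  have h1 : Set.EqOn (dy 1 fun q => H q ^ 2)
      (fun q => exB q.1 * (4 * (exBeta q ^ (3 : ℤ) * q.2 1 ^ (-2 : ℤ)))
        + -2 * (exBeta q ^ (4 : ℤ) * q.2 1 ^ (-3 : ℤ))) exDom := fun q hq => by
    simp [dy_exF'_sq hH hq]
  have hy := hp.2.1.ne'
  have hβ := (exBeta_pos hp).ne'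
  have e0 := dy_congr isOpen_exDom h0 hp
  have e1 := dy_congr isOpen_exDom h1 hp
  simp only [Matrix.det_fin_two, metricTensor, Matrix.of_apply, e0, e1, dy_exB_mul_add hp,
    dy_exBeta_pow_mul hp]
  norm_num
  field_simp
  ring

/-- The connection `exGamma` annihilates `(e^φ F)² = β⁴ / y₂²`. -/
lemma dx_exF'_sq_eq (hp : p ∈ exDom) (i : Fin 2) :
    dx i (fun q => H q ^ 2) p =
      ∑ j, (∑ k, exGamma j i k p.1 * p.2 k) * dy j (fun q => H q ^ 2) p := by
  have hy := hp.2.1.ne'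
  have hβ := (exBeta_pos hp).ne'
  rw [dx_congr isOpen_exDom hH hp, dx_exBeta_pow_mul hp]
  simp only [Fin.sum_univ_two, dy_exF'_sq hH hp, exGamma]
  have h0 : p.2 0 = (exBeta p - exB p.1 * p.2 1) / 2 := by
    simp only [exBeta]
    ring
  rw [h0]
  fin_cases i
  · simp [fderiv_exB hp.1]
    field_simp
    ring
  · simp
    field_simp
    ring

end Berwald

section Factor

variable {P : Plane × Plane → ℝ}
  (hP : ∀ q ∈ exDom, P q = 3 / 2 * (Real.log (exBeta q) - Real.log (q.2 1)))

include hP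

lemma dy_exPhi (hp : p ∈ exDom) (i : Fin 2) :
    dy i P p = ![3 * (exBeta p ^ (-1 : ℤ) * p.2 1 ^ (0 : ℤ)),
      exB p.1 * (3 / 2 * (exBeta p ^ (-1 : ℤ) * p.2 1 ^ (0 : ℤ))) +
        -(3 / 2) * (exBeta p ^ (0 : ℤ) * p.2 1 ^ (-1 : ℤ))] i := by
  have hβ := differentiableAt_exBeta hp
  have hy : DifferentiableAt ℝ (fun q : Plane × Plane => q.2 1) p := by fun_prop
  have l1 := (Real.hasDerivAt_log (exBeta_pos hp).ne').const_mul (3 / 2)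
  have l2 := (Real.hasDerivAt_log hp.2.1.ne').const_mul (-(3 / 2))
  have d1 : DifferentiableAt ℝ (fun q => 3 / 2 * Real.log (exBeta q)) p :=
    l1.differentiableAt.comp p hβ
  have d2 : DifferentiableAt ℝ (fun q : Plane × Plane => -(3 / 2) * Real.log (q.2 1)) p :=
    DifferentiableAt.comp p (f := fun q : Plane × Plane => q.2 1) l2.differentiableAt hy
  have hP' : Set.EqOn P (fun q => 3 / 2 * Real.log (exBeta q) + -(3 / 2) * Real.log (q.2 1))
      exDom := fun q hq => by rw [hP q hq]; ring
  rw [dy_congr isOpen_exDom hP' hp, dy_add d1 d2,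
    dy_comp (g := fun s => 3 / 2 * Real.log s) l1 hβ,
    dy_comp (g := fun s => -(3 / 2) * Real.log s) l2 hy, dy_exBeta hp, dy_coord]
  fin_cases i <;> simp <;> ring

lemma dx_exPhi (hp : p ∈ exDom) (i : Fin 2) :
    dx i P p = 3 / 2 * (exBeta p)⁻¹ *
      (fderiv ℝ exB p.1 (EuclideanSpace.single i 1) * p.2 1) := by
  have hβ := differentiableAt_exBeta hp
  have hy : DifferentiableAt ℝ (fun q : Plane × Plane => q.2 1) p := by fun_prop
  have l1 := (Real.hasDerivAt_log (exBeta_pos hp).ne').const_mul (3 / 2)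
  have l2 := (Real.hasDerivAt_log hp.2.1.ne').const_mul (-(3 / 2))
  have d1 : DifferentiableAt ℝ (fun q => 3 / 2 * Real.log (exBeta q)) p :=
    l1.differentiableAt.comp p hβ
  have d2 : DifferentiableAt ℝ (fun q : Plane × Plane => -(3 / 2) * Real.log (q.2 1)) p :=
    DifferentiableAt.comp p (f := fun q : Plane × Plane => q.2 1) l2.differentiableAt hy
  have hP' : Set.EqOn P (fun q => 3 / 2 * Real.log (exBeta q) + -(3 / 2) * Real.log (q.2 1))
      exDom := fun q hq => by rw [hP q hq]; ring
  rw [dx_congr isOpen_exDom hP' hp, dx_add d1 d2,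
    dx_comp (g := fun s => 3 / 2 * Real.log s) l1 hβ,
    dx_comp (g := fun s => -(3 / 2) * Real.log s) l2 hy, dx_exBeta hp, dx_coord]
  ring

/-- The quantity in the regularity condition of an anisotropic conformal change is constant. -/
lemma exPhi_regular {G : Plane × Plane → ℝ} (hG : ∀ q ∈ exDom, G q ^ 2 = q.2 1 * exBeta q)
    (hGd : DifferentiableAt ℝ G p) (hp : p ∈ exDom) :
    G p ^ 2 * (∑ i, ∑ j, (dy i (dy j P) p + dy i P p * dy j P p) * frameM G i p * frameM G j p)
      + frameSign G p = 8 := by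
  have h0 : Set.EqOn (dy 0 P)
      (fun q => 3 * (exBeta q ^ (-1 : ℤ) * q.2 1 ^ (0 : ℤ))) exDom := fun q hq => by
    simp [dy_exPhi hP hq]
  have h1 : Set.EqOn (dy 1 P)
      (fun q => exB q.1 * (3 / 2 * (exBeta q ^ (-1 : ℤ) * q.2 1 ^ (0 : ℤ)))
        + -(3 / 2) * (exBeta q ^ (0 : ℤ) * q.2 1 ^ (-1 : ℤ))) exDom := fun q hq => by
    simp [dy_exPhi hP hq]
  have hy := hp.2.1.ne'
  have hβ := (exBeta_pos hp).ne'
  have e0 := dy_congr isOpen_exDom h0 hp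
  have e1 := dy_congr isOpen_exDom h1 hp
  have m0 := mul_frameM_exF hG hGd hp 0
  have m1 := mul_frameM_exF hG hGd hp 1
  have hy0 : p.2 0 = (exBeta p - exB p.1 * p.2 1) / 2 := by
    simp only [exBeta]
    ring
  have hsum : G p ^ 2 * (∑ i, ∑ j, (dy i (dy j P) p + dy i P p * dy j P p) * frameM G i p *
      frameM G j p) = ∑ i, ∑ j, (dy i (dy j P) p + dy i P p * dy j P p) * (G p * frameM G i p) *
      (G p * frameM G j p) := by
    simp only [Fin.sum_univ_two]
    ring
  rw [hsum, frameSign_exF hG hp]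
  simp only [Fin.sum_univ_two, m0, m1, e0, e1, dy_exB_mul_add hp, dy_exBeta_pow_mul hp,
    dy_exPhi hP hp, hy0]
  norm_num
  field_simp
  ring

/-- The horizontal derivative of `φ` with respect to `F`: `δ₁φ = 0` and `δ₂φ = -(3/2) ∂b/∂x₁`. -/
lemma horDeriv_exPhi {G : Plane × Plane → ℝ}
    (hG : ∀ q ∈ exDom, G q ^ 2 = q.2 1 * exBeta q) (hl : IsLocalFinsler exDom G) (hp : p ∈ exDom)
    (i : Fin 2) : horDeriv G i P p = ![0, -(3 / 2) * exDB p.1] i := by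
  have hN := fun i j => hl.barthelCoeff_eq_of_dx_sq exGammaF_symm
    (fun q hq => dx_exF_sq_eq hG hq) hp i j
  have hy := hp.2.1.ne'
  have hβ := (exBeta_pos hp).ne'
  have hy0 : p.2 0 = (exBeta p - exB p.1 * p.2 1) / 2 := by
    simp only [exBeta]
    ring
  simp only [horDeriv, hN, dx_exPhi hP hp, dy_exPhi hP hp, Fin.sum_univ_two, exGammaF, hy0]
  fin_cases i
  · simp [fderiv_exB hp.1]
    field_simp
    ring
  · simp
    field_simp
    ring

lemma hScalars_exPhi_ne_zero {G : Plane × Plane → ℝ}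
    (hG : ∀ q ∈ exDom, G q ^ 2 = q.2 1 * exBeta q) (hl : IsLocalFinsler exDom G)
    (hp : p ∈ exDom) : hScalar1 G P p ≠ 0 ∧ hScalar2 G P p ≠ 0 := by
  have hy := hp.2.1.ne'
  have hb := exDB_ne_zero hp.1
  have hm := mul_frameM_exF hG (hl.differentiableAt hp) hp 1
  have hm1 : frameM G 1 p ≠ 0 := by
    intro h0
    rw [h0] at hm
    simp [hy] at hm
  simp only [hScalar1, hScalar2, frameEll, Fin.sum_univ_two, horDeriv_exPhi hP hG hl hp,
    frameSign_exF hG hp]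
  constructor
  · simp [hb, hy, exF_ne_zero hG hp]
  · simp [hb, hm1]

end Factor

end ExampleCalculus

/-! ### The metrics of the example on the surface -/

section ExampleValues

variable {v : TB exM}

/-- The coordinate expression of `F`. -/
noncomputable def exFCoord (p : Plane × Plane) : ℝ :=
  1 / p.1 1 * Real.sqrt (2 * p.2 0 * p.2 1 * p.1 1 ^ 2 + exC p.1 * p.2 1 ^ 2)

/-- The coordinate expression of `φ`. -/
noncomputable def exPhiCoord (p : Plane × Plane) : ℝ :=
  3 / 2 * Real.log ((2 * p.1 1 ^ 2 * p.2 0 + exC p.1 * p.2 1) / (p.1 1 ^ 2 * p.2 1))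

variable {p : Plane × Plane}

lemma exFCoord_eq (hp : p ∈ exDom) : exFCoord p = Real.sqrt (p.2 1 * exBeta p) := by
  have hx := hp.1.1
  have h : 2 * p.2 0 * p.2 1 * p.1 1 ^ 2 + exC p.1 * p.2 1 ^ 2 =
      p.1 1 ^ 2 * (p.2 1 * exBeta p) := by
    unfold exBeta exB
    field_simp
  rw [exFCoord, h, Real.sqrt_mul (by positivity), Real.sqrt_sq hx.le]
  field_simp

lemma exFCoord_sq (hp : p ∈ exDom) : exFCoord p ^ 2 = p.2 1 * exBeta p := by
  rw [exFCoord_eq hp, Real.sq_sqrt (mul_pos hp.2.1 (exBeta_pos hp)).le]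

lemma exPhiCoord_eq (hp : p ∈ exDom) :
    exPhiCoord p = 3 / 2 * (Real.log (exBeta p) - Real.log (p.2 1)) := by
  have hx := hp.1.1
  have hy := hp.2.1
  rw [exPhiCoord, ← Real.log_div (exBeta_pos hp).ne' hy.ne']
  congr 2
  unfold exBeta exB
  field_simp

/-- In coordinates, `e^φ F = β² / y₂`. -/
lemma exp_exPhiCoord_mul (hp : p ∈ exDom) :
    Real.exp (exPhiCoord p) * exFCoord p = exBeta p ^ 2 / p.2 1 := by
  have hy := hp.2.1
  have hβ := exBeta_pos hp
  -- both factors are powers of the square root of `t = β / y₂`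
  set t := exBeta p / p.2 1 with ht
  have htpos : 0 < t := div_pos hβ hy
  have h1 : exPhiCoord p = 3 * (Real.log t / 2) := by
    rw [exPhiCoord_eq hp, ht, Real.log_div hβ.ne' hy.ne']
    ring
  have h2 : Real.exp (Real.log t / 2) = Real.sqrt t := by
    rw [Real.exp_half, Real.exp_log htpos]
  have h3 : exFCoord p = p.2 1 * Real.sqrt t := by
    have : p.2 1 * exBeta p = p.2 1 ^ 2 * t := by rw [ht]; field_simp
    rw [exFCoord_eq hp, this, Real.sqrt_mul (by positivity), Real.sqrt_sq hy.le]
  have h4 : Real.exp (exPhiCoord p) = Real.sqrt t ^ 3 := by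
    rw [h1, ← h2, ← Real.exp_nat_mul]
    norm_num
  have h5 : Real.sqrt t ^ 2 = t := Real.sq_sqrt htpos.le
  calc _ = p.2 1 * (Real.sqrt t ^ 2) ^ 2 := by rw [h3, h4]; ring
    _ = _ := by rw [h5, ht]; field_simp

lemma contDiffOn_exFCoord : ContDiffOn ℝ ∞ exFCoord exDom := by
  refine ContDiffOn.congr (ContDiffOn.sqrt ((contDiff_dir 1).contDiffOn.mul
    (contDiffOn_exBeta.mono exDom_sub)) fun p hp => ?_) fun p hp => exFCoord_eq hp
  exact (mul_pos hp.2.1 (exBeta_pos hp)).ne'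

lemma contDiffOn_exPhiCoord : ContDiffOn ℝ ∞ exPhiCoord exDom := by
  refine ContDiffOn.congr (contDiffOn_const.mul (ContDiffOn.sub
    ((contDiffOn_exBeta.mono exDom_sub).log fun p hp => (exBeta_pos hp).ne')
    ((contDiff_dir 1).contDiffOn.log fun p hp => hp.2.1.ne'))) fun p hp => exPhiCoord_eq hp

lemma smoothOn_of_coord {f : Plane × Plane → ℝ} (hf : ContDiffOn ℝ ∞ f exDom) :
    SmoothOn exA (fun v => f (exX v, exY v)) :=
  (contMDiffOn_iff_contDiffOn.2 hf).comp contMDiff_exX_exY.contMDiffOn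
    fun _ hv => mem_exDom_of_mem_exA hv

lemma exF_eq_coord (v : TB exM) : exF v = exFCoord (exX v, exY v) := rfl

lemma exPhi_eq_coord (v : TB exM) : exPhi v = exPhiCoord (exX v, exY v) := rfl

lemma conformalChange_exPhi_exF (hv : v ∈ exA) :
    conformalChange exPhi exF v = exBeta (exX v, exY v) ^ 2 / exY v 1 := by
  rw [conformalChange, exF_eq_coord, exPhi_eq_coord,
    exp_exPhiCoord_mul (mem_exDom_of_mem_exA hv)]

lemma smoothOn_exF : SmoothOn exA exF := smoothOn_of_coord contDiffOn_exFCoord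

lemma smoothOn_exPhi : SmoothOn exA exPhi := smoothOn_of_coord contDiffOn_exPhiCoord

lemma smoothOn_conformalChange_exF : SmoothOn exA (conformalChange exPhi exF) :=
  smoothOn_of_coord (contDiffOn_exPhiCoord.exp.mul contDiffOn_exFCoord)

end ExampleValues

section ExampleBundle

lemma exists_mem_exA (x : exM) : ∃ v ∈ exA, v.1 = x := by
  have he := chart_mem_atlas Plane x
  set e := chartAt Plane x
  -- the vector `(b² + 1 - b, 1)` has `β = 2 b² - b + 2 > 0`
  set y : Plane := WithLp.toLp 2 ![(exB (x : Plane)) ^ 2 + 1 - exB (x : Plane), 1] with hy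
  have hx : e x = (x : Plane) := exM_chart_apply he x
  have hsrc : x ∈ e.source := mem_chart_source _ x
  have hdom : ((x : Plane), y) ∈ exDom := by
    rw [exDom_eq]
    refine ⟨⟨x.2, ?_⟩, ?_⟩
    · simp only [Set.mem_preimage, exBeta, hy, Set.mem_Ioi]
      simp
      nlinarith [sq_nonneg (exB (x : Plane) - 1)]
    · simp [hy]
  rw [← localDom_exA he] at hdom
  refine ⟨_, hdom.2, ?_⟩
  change e.symm (x : Plane) = x
  rw [← hx, e.left_inv hsrc]

lemma isConicSubbundle_exA : IsConicSubbundle exA where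
  isOpen := isOpen_exDom.preimage contMDiff_exX_exY.continuous |> fun h => by
    convert h using 1
    ext v
    exact ⟨fun hv => mem_exDom_of_mem_exA hv, fun hv => hv.2⟩
  nonempty := by
    obtain ⟨v, hv, -⟩ := exists_mem_exA nonempty_exM.some
    exact ⟨v, hv⟩
  ne_zero v hv h0 := by
    have h1 : exY v = 0 := by
      unfold exY
      rw [h0]
      exact map_zero (mfderiv 𝓘(ℝ, Plane) 𝓘(ℝ, Plane) (Subtype.val : exM → Plane) v.1)
    have h2 := hv.1
    rw [h1] at h2
    simp at h2
  scale_mem v hv t ht := by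
    refine ⟨?_, ?_⟩
    · rw [exY_scale]
      exact mul_pos ht hv.1
    · rw [exY_scale, exX_scale]
      have := mul_pos ht hv.2
      simp only [PiLp.smul_apply, smul_eq_mul]
      linarith
  proj_surj := exists_mem_exA

lemma exPhi_scale {v : TB exM} (hv : v ∈ exA) {t : ℝ} (ht : 0 < t) :
    exPhi (scale t v) = exPhi v := by
  have hx : 0 < exX v 1 := v.1.2.1
  have hy := hv.1
  simp only [exPhi, exX_scale, exY_scale, PiLp.smul_apply, smul_eq_mul]
  congr 2
  field_simp

lemma exF_scale {v : TB exM} {t : ℝ} (ht : 0 < t) : exF (scale t v) = t * exF v := by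
  simp only [exF, exX_scale, exY_scale, PiLp.smul_apply, smul_eq_mul]
  have : 2 * (t * exY v 0) * (t * exY v 1) * exX v 1 ^ 2 + exC (exX v) * (t * exY v 1) ^ 2 =
    t ^ 2 * (2 * exY v 0 * exY v 1 * exX v 1 ^ 2 + exC (exX v) * exY v 1 ^ 2) := by ring
  rw [this, Real.sqrt_mul (by positivity), Real.sqrt_sq ht.le]
  ring

variable {e : OpenPartialHomeomorph exM Plane}

lemma localRep_eq_coord (he : e ∈ atlas Plane exM) {f : Plane × Plane → ℝ} {p : Plane × Plane}
    (hp : p ∈ exDom) : localRep e (fun v => f (exX v, exY v)) p = f p := by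
  rw [← localDom_exA he] at hp
  simp only [localRep, exX_tangentOf he hp.1, exY_tangentOf he hp.1]

lemma localRep_exF_sq (he : e ∈ atlas Plane exM) :
    ∀ q ∈ exDom, localRep e exF q ^ 2 = q.2 1 * exBeta q := fun _ hq =>
  (congrArg (· ^ 2) (localRep_eq_coord he (f := exFCoord) hq)).trans (exFCoord_sq hq)

lemma localRep_exPhi (he : e ∈ atlas Plane exM) :
    ∀ q ∈ exDom, localRep e exPhi q = 3 / 2 * (Real.log (exBeta q) - Real.log (q.2 1)) :=
  fun _ hq => (localRep_eq_coord he (f := exPhiCoord) hq).trans (exPhiCoord_eq hq)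

lemma localRep_conformalChange_sq (he : e ∈ atlas Plane exM) :
    ∀ q ∈ exDom, localRep e (conformalChange exPhi exF) q ^ 2 =
      1 * (exBeta q ^ (4 : ℤ) * q.2 1 ^ (-2 : ℤ)) := by
  intro q hq
  have h := (localRep_eq_coord he (f := fun p => Real.exp (exPhiCoord p) * exFCoord p) hq).trans
    (exp_exPhiCoord_mul hq)
  have h' : localRep e (conformalChange exPhi exF) q = exBeta q ^ 2 / q.2 1 := h
  have hy := hq.2.1
  rw [h', zpow_neg]
  norm_cast
  field_simp

lemma isConicPseudoFinsler_exF : IsConicPseudoFinsler exA exF where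
  conic := isConicSubbundle_exA
  smooth := smoothOn_exF
  homogeneous _ _ _ ht := exF_scale ht
  nondegenerate e he p hp := by
    rw [localDom_exA he] at hp
    rw [det_metricTensor_exF (localRep_exF_sq he) hp]
    norm_num

lemma isConicPseudoFinsler_conformalChange :
    IsConicPseudoFinsler exA (conformalChange exPhi exF) where
  conic := isConicSubbundle_exA
  smooth := smoothOn_conformalChange_exF
  homogeneous v hv t ht := by
    simp only [conformalChange, exPhi_scale hv ht, exF_scale ht]
    ring
  nondegenerate e he p hp := by
    rw [localDom_exA he] at hp
    rw [det_metricTensor_exF' (localRep_conformalChange_sq he) hp]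
    have := exBeta_pos hp
    have := hp.2.1
    positivity

/-- The components of a tangent vector of `exM` at `x`, as a linear map. -/
noncomputable def exComp (x : exM) : TangentSpace 𝓘(ℝ, Plane) x →ₗ[ℝ] Plane where
  toFun v := mfderiv 𝓘(ℝ, Plane) 𝓘(ℝ, Plane) (Subtype.val : exM → Plane) x v
  map_add' v w := map_add (mfderiv 𝓘(ℝ, Plane) 𝓘(ℝ, Plane) (Subtype.val : exM → Plane) x) v w
  map_smul' c v := map_smul (mfderiv 𝓘(ℝ, Plane) 𝓘(ℝ, Plane) (Subtype.val : exM → Plane) x) c v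

lemma exComp_mfderiv_symm (he : e ∈ atlas Plane exM) {u : Plane} (hu : u ∈ e.target) (y : Plane) :
    exComp (e.symm u) (mfderiv 𝓘(ℝ, Plane) 𝓘(ℝ, Plane) e.symm u y) = y :=
  mfderiv_val_mfderiv_symm he hu y

lemma exComp_bijective (x : exM) : Function.Bijective (exComp x) := by
  have he := chart_mem_atlas Plane x
  have hu := mem_chart_target Plane x
  have hx : (chartAt Plane x).symm (chartAt Plane x x) = x :=
    (chartAt Plane x).left_inv (mem_chart_source _ x)
  have key : Function.Bijective (exComp ((chartAt Plane x).symm (chartAt Plane x x))) := by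
    have hb := mfderiv_symm_bijective he hu
    constructor
    · intro v w hvw
      obtain ⟨v, rfl⟩ := hb.2 v
      obtain ⟨w, rfl⟩ := hb.2 w
      have h1 := exComp_mfderiv_symm he hu v
      have h2 := exComp_mfderiv_symm he hu w
      exact congrArg _ (h1.symm.trans (hvw.trans h2))
    · intro y
      exact ⟨_, exComp_mfderiv_symm he hu y⟩
  rwa [hx] at key

/-- The symmetric bilinear form `y₁ z₂ + y₂ z₁ + b y₂ z₂` on the plane. -/
noncomputable def exForm (b : ℝ) : Plane →ₗ[ℝ] Plane →ₗ[ℝ] ℝ :=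
  LinearMap.mk₂ ℝ (fun y z => y 0 * z 1 + y 1 * z 0 + b * (y 1 * z 1))
    (fun y y' z => by simp only [PiLp.add_apply]; ring)
    (fun c y z => by simp only [PiLp.smul_apply, smul_eq_mul]; ring)
    (fun y z z' => by simp only [PiLp.add_apply]; ring)
    (fun c y z => by simp only [PiLp.smul_apply, smul_eq_mul]; ring)

lemma exForm_apply (b : ℝ) (y z : Plane) :
    exForm b y z = y 0 * z 1 + y 1 * z 0 + b * (y 1 * z 1) := rfl

/-- The Lorentzian metric `2 dx₁ dx₂ + b dx₂²` on `exM`. -/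
noncomputable def exMetric : PseudoRiemannianMetric exM where
  form x := (exForm (exB (x : Plane))).compl₁₂ (exComp x) (exComp x)
  symm x v w := by
    simp only [LinearMap.compl₁₂_apply, exForm_apply]
    ring
  nondegenerate x v h := by
    obtain ⟨w0, h0⟩ := (exComp_bijective x).2 (EuclideanSpace.single 0 1)
    obtain ⟨w1, h1⟩ := (exComp_bijective x).2 (EuclideanSpace.single 1 1)
    have e0 := h w0
    have e1 := h w1
    simp only [LinearMap.compl₁₂_apply, exForm_apply, h0, h1] at e0 e1
    simp at e0 e1
    rw [e0] at e1
    apply (exComp_bijective x).1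
    rw [map_zero]
    ext i
    fin_cases i
    · simpa using e1
    · simpa using e0
  smooth e he i j := by
    refine ContDiffOn.congr (f := fun u => exForm (exB u) (EuclideanSpace.single i 1)
      (EuclideanSpace.single j 1)) ?_ fun u hu => ?_
    · rw [exM_chart_target he]
      simp only [exForm_apply]
      exact contDiffOn_const.add (contDiffOn_exB.mul contDiffOn_const)
    · simp only [LinearMap.compl₁₂_apply, exM_chart_symm he hu, exComp_mfderiv_symm he hu]

lemma isInducedBy_exMetric : IsInducedBy exA exF exMetric := by
  intro v hv
  refine (exFCoord_sq (mem_exDom_of_mem_exA hv)).trans ?_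
  change exY v 1 * exBeta (exX v, exY v) = exForm (exB (exX v)) (exY v) (exY v)
  simp only [exForm_apply, exBeta]
  ring

lemma isConicPseudoRiemannian_exF : IsConicPseudoRiemannian exA exF :=
  ⟨isConicPseudoFinsler_exF, exMetric, isInducedBy_exMetric⟩

lemma isAnisotropicConformalFactor_exPhi : IsAnisotropicConformalFactor exA exF exPhi where
  smooth := smoothOn_exPhi
  homogeneous _ hv _ ht := exPhi_scale hv ht
  regular e he p hp := by
    have hd := (isConicPseudoFinsler_exF.isLocalFinsler he).differentiableAt hp
    rw [localDom_exA he] at hp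
    rw [exPhi_regular (localRep_exPhi he) (localRep_exF_sq he) hd hp]
    norm_num

lemma conformalChange_exPhi_exF_eq {v : TB exM} (hv : v ∈ exA) :
    conformalChange exPhi exF v =
      4 * exY v 1 * (exC (exX v) / (2 * exX v 1 ^ 2) + exY v 0 / exY v 1) ^ 2 := by
  have hx : 0 < exX v 1 := v.1.2.1
  have hy := hv.1
  rw [conformalChange_exPhi_exF hv]
  simp only [exBeta, exB]
  field_simp
  ring

lemma berwaldCoeff_conformalChange (he : e ∈ atlas Plane exM) {p : Plane × Plane}
    (hp : p ∈ localDom e exA) (i j k : Fin 2) :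
    berwaldCoeff (localRep e (conformalChange exPhi exF)) i j k p = exGamma i j k p.1 := by
  refine (isConicPseudoFinsler_conformalChange.isLocalFinsler he).berwaldCoeff_eq_of_dx_sq
    exGamma_symm (fun q hq => ?_) hp i j k
  rw [localDom_exA he] at hq
  exact dx_exF'_sq_eq (localRep_conformalChange_sq he) hq

lemma isConicPseudoBerwald_conformalChange :
    IsConicPseudoBerwald exA (conformalChange exPhi exF) where
  finsler := isConicPseudoFinsler_conformalChange
  berwaldCurv_eq_zero e he p hp i j k l := by
    refine (isConicPseudoFinsler_conformalChange.isLocalFinsler he).berwaldCurv_eq_zero_of_dx_sq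
      exGamma_symm (fun q hq => ?_) hp i j k l
    rw [localDom_exA he] at hq
    exact dx_exF'_sq_eq (localRep_conformalChange_sq he) hq

lemma hScalarsNowhereVanish_exPhi : HScalarsNowhereVanish exA exF exPhi := by
  intro e he p hp
  have hl := isConicPseudoFinsler_exF.isLocalFinsler he
  rw [localDom_exA he] at hp hl
  exact hScalars_exPhi_ne_zero (localRep_exPhi he) (localRep_exF_sq he) hl hp

/-! ### The obstruction to metrizability -/

/-- The logarithmic derivative of the determinant of a pseudo-Riemannian metric is twice the trace
of its Christoffel symbols. -/
lemma PseudoRiemannianMetric.fderiv_det_coeff {M : Type*} [TopologicalSpace M]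
    [ChartedSpace Plane M] [IsManifold 𝓘(ℝ, Plane) ∞ M] (a : PseudoRiemannianMetric M)
    {e : OpenPartialHomeomorph M Plane} (he : e ∈ atlas Plane M) {u : Plane} (hu : u ∈ e.target)
    (k : Fin 2) :
    fderiv ℝ (fun w => (a.coeff e w).det) u (EuclideanSpace.single k 1) =
      2 * (a.coeff e u).det * ∑ i, a.christoffel e i i k u := by
  have hd := fun i j => a.differentiableAt_coeff he i j hu
  have hD : fderiv ℝ (fun w => (a.coeff e w).det) u (EuclideanSpace.single k 1) =
      a.dcoeff e k 0 0 u * a.coeff e u 1 1 + a.coeff e u 0 0 * a.dcoeff e k 1 1 u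
        - (a.dcoeff e k 0 1 u * a.coeff e u 1 0 + a.coeff e u 0 1 * a.dcoeff e k 1 0 u) := by
    simp only [Matrix.det_fin_two]
    rw [fderiv_fun_sub ((hd 0 0).fun_mul (hd 1 1)) ((hd 0 1).fun_mul (hd 1 0)),
      fderiv_fun_mul (hd 0 0) (hd 1 1), fderiv_fun_mul (hd 0 1) (hd 1 0)]
    simp [PseudoRiemannianMetric.dcoeff]
    ring
  have hchr := a.sum_coeff_mul_christoffel he hu
  have c00 := hchr 0 0 k
  have c01 := hchr 0 1 k
  have c10 := hchr 1 0 k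
  have c11 := hchr 1 1 k
  have hs := a.coeff_symm e u 0 1
  have d0 := a.dcoeff_symm e 0 0 1 u
  have d1 := a.dcoeff_symm e 1 0 1 u
  have dk := a.dcoeff_symm e k 0 1 u
  rw [hD, Matrix.det_fin_two]
  simp only [Fin.sum_univ_two] at c00 c01 c10 c11 ⊢
  clear hD hchr hd
  fin_cases k <;> simp only [Fin.zero_eta, Fin.mk_one, Fin.isValue] at * <;>
    rw [← hs] at * <;> rw [← d0, ← d1] at *
  · linear_combination (-2) * a.coeff e u 1 1 * c00 + 2 * a.coeff e u 0 1 * c10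
      - 2 * a.coeff e u 0 0 * c11 + 2 * a.coeff e u 0 1 * c01
  · linear_combination (-2) * a.coeff e u 1 1 * c00 + 2 * a.coeff e u 0 1 * c10
      - 2 * a.coeff e u 0 0 * c11 + 2 * a.coeff e u 0 1 * c01

/-- The trace of the connection `exGamma` is the one-form `(3/2) (∂b/∂x₁) dx₂`. It is not closed
because `∂²b/∂x₁² ≠ 0`, whereas the trace of a Levi-Civita connection is half the logarithmic
derivative of the determinant of the metric. -/
lemma not_isRiemannMetrizable_example :
    ¬ IsRiemannMetrizable exA (conformalChange exPhi exF) := by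
  rintro ⟨a, ha⟩
  set x : exM := nonempty_exM.some
  have he := chart_mem_atlas Plane x
  set e := chartAt Plane x
  have hΓ : ∀ u ∈ e.target, ∀ i j k, a.christoffel e i j k u = exGamma i j k u := by
    intro u hu i j k
    obtain ⟨v, hv, hvu⟩ := exists_mem_exA (e.symm u)
    have hp : (u, exY v) ∈ exDom := by
      have := mem_exDom_of_mem_exA hv
      have hx : exX v = u := by
        unfold exX
        rw [hvu, exM_chart_symm he hu]
      rwa [hx] at this
    rw [← localDom_exA he] at hp
    rw [← berwaldCoeff_conformalChange he hp]
    exact (ha e he _ hp i j k).symm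
  set D : Plane → ℝ := fun w => (a.coeff e w).det
  have hD0 : Set.EqOn (fun u => fderiv ℝ D u (EuclideanSpace.single 0 1)) (fun _ => 0)
      e.target := by
    intro u hu
    simp only
    rw [a.fderiv_det_coeff he hu]
    simp [Fin.sum_univ_two, hΓ u hu, exGamma]
  have hD1 : Set.EqOn (fun u => fderiv ℝ D u (EuclideanSpace.single 1 1))
      (fun u => 3 * (D u * exDB u)) e.target := by
    intro u hu
    simp only
    rw [a.fderiv_det_coeff he hu]
    simp [Fin.sum_univ_two, hΓ u hu, exGamma, D]
    ring
  have hu : e x ∈ e.target := mem_chart_target Plane x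
  have hn := e.open_target.mem_nhds hu
  have hsm : ContDiffOn ℝ ∞ D e.target := by
    simp only [D, Matrix.det_fin_two]
    exact ((a.contDiffOn_coeff he 0 0).mul (a.contDiffOn_coeff he 1 1)).sub
      ((a.contDiffOn_coeff he 0 1).mul (a.contDiffOn_coeff he 1 0))
  have hxM : e x ∈ exM := by
    have := hu
    rwa [exM_chart_target he] at this
  have hcomm := fderiv_fderiv_comm (hsm.contDiffAt hn) (EuclideanSpace.single 0 1)
    (EuclideanSpace.single 1 1)
  have hDd : DifferentiableAt ℝ D (e x) := (hsm.contDiffAt hn).differentiableAt (by simp)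
  have hBd := differentiableAt_exDB hxM
  rw [(hD0.eventuallyEq_of_mem hn).fderiv_eq, (hD1.eventuallyEq_of_mem hn).fderiv_eq,
    fderiv_const_mul (hDd.fun_mul hBd), fderiv_fun_mul hDd hBd] at hcomm
  have h0 := hD0 hu
  simp only at h0
  simp [h0] at hcomm
  rcases hcomm with h | h
  · exact a.det_coeff_ne_zero he hu h
  · exact fderiv_exDB_ne_zero hxM h

end ExampleBundle

end ConicFinsler

open ConicFinsler in
theorem mainTheorem3 :
    -- the metrizability criterion
    (∀ (M : Type*) [TopologicalSpace M] [ChartedSpace Plane M] [IsManifold 𝓘(ℝ, Plane) ∞ M]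
        (A : Set (TB M)) (F φ : TB M → ℝ),
        IsConicPseudoRiemannian A F →
        IsAnisotropicConformalFactor A F φ →
        IsConicPseudoBerwald A (conformalChange φ F) →
        (IsRiemannMetrizableBy A (conformalChange φ F) F ↔ HScalarsVanish A F φ) ∧
        (HScalarsVanish A F φ ↔ IsHorizontallyConstant A F φ)) ∧
    -- the failure of Szabó's metrization theorem
    (IsConicPseudoRiemannian exA exF ∧
      IsAnisotropicConformalFactor exA exF exPhi ∧
      (∀ v ∈ exA, conformalChange exPhi exF v =
        4 * exY v 1 * (exC (exX v) / (2 * exX v 1 ^ 2) + exY v 0 / exY v 1) ^ 2) ∧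
      IsConicPseudoBerwald exA (conformalChange exPhi exF) ∧
      HScalarsNowhereVanish exA exF exPhi ∧
      ¬ IsRiemannMetrizableBy exA (conformalChange exPhi exF) exF ∧
      ¬ IsRiemannMetrizable exA (conformalChange exPhi exF)) := by
  refine ⟨fun M _ _ _ A F φ hF hφ hB => ?_, ?_⟩
  · have h := hScalarsVanish_iff (φ := φ) hF.finsler
    exact ⟨(isRiemannMetrizableBy_iff hF hφ.smooth hB.finsler).trans h.symm, h⟩
  · exact ⟨isConicPseudoRiemannian_exF, isAnisotropicConformalFactor_exPhi,
      fun v hv => conformalChange_exPhi_exF_eq hv, isConicPseudoBerwald_conformalChange,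
      hScalarsNowhereVanish_exPhi,
      fun ⟨a, _, ha⟩ => not_isRiemannMetrizable_example ⟨a, ha⟩,
      not_isRiemannMetrizable_example⟩
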